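/- Let $\mathcal S$ be the unit sphere in $\mathbb R^3$ and let $\mathcal C\subset\mathcal S$ be a simple closed curve made of finitely many regular $C^2$ arcs (corners are allowed, cusps are not). Suppose $\mathcal C$ divides $\mathcal S$ into two disjoint open parts $\mathcal S_1,\mathcal S_2$ with $\mathcal S\setminus\mathcal C=\mathcal S_1\cup\mathcal S_2$ and $\partial\mathcal S_1=\partial\mathcal S_2=\mathcal C$. Let $\vec t$ be the unit tangent of $\mathcal C$ oriented in accordance with $\mathcal S_2$ (seen from outside the sphere, $\mathcal S_2$ lies to the left of $\mathcal C$). Put $$U^*(x,y)=-\frac1{4\pi}\log|1-\langle x,y\rangle|,\qquad \underline{\mathrm{curl}}_{\mathcal S}f(y)=\nabla_{\mathcal S}f(y)\times y ,$$ and, for a continuous density $\mu:\mathcal C\to\mathbb R$, define the double layer potential $$(\widetilde W\mu)(x)=\int_{\mathcal C}\mu(y)\,\big[\underline{\mathrm{curl}}_{\mathcal S,y}U^*(x,y)\cdot\vec t(y)\big]\,ds_y,\qquad x\in\mathcal S\setminus\mathcal C .$$ Let $x_0\in\mathcal C$ and let $\alpha(x_0)\in(0,2\pi)$ be the interior angle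 of $\mathcal C$ at $x_0$ with respect to $\mathcal S_2$. Then: 1. The principal value $$(K\mu)(x_0)=\lim_{\varepsilon\to0^+}\int_{\{y\in\mathcal C:\,|y-x_0|\ge\varepsilon\}}\mu(y)\,\big[\underline{\mathrm{curl}}_{\mathcal S,y}U^*(x_0,y)\cdot\vec t(y)\big]\,ds_y$$ exists. 2. The one-sided limit from $\mathcal S_2$ exists and $$(\gamma_0^{\mathcal S_2}\widetilde W\mu)(x_0):=\lim_{\mathcal S_2\ni x\to x_0}(\widetilde W\mu)(x)=(K\mu)(x_0)+\Big(1-\frac{\alpha(x_0)}{2\pi}\Big)\mu(x_0).$$ 3. If the unit tangent is continuous at $x_0$, then $\alpha(x_0)=\pi$. 4. The one-sided limit $(\gamma_0^{\mathcal S_1}\widetilde W\mu)(x_0)$ from $\mathcal S_1$ of the double layer potential formed with the tangent oriented in accordance with $\mathcal S_1$, that is, with $-\vec t$ in place of $\vec t$, exists, and $$(\gamma_0^{\mathcal S_2}\widetilde W\mu)(x_0)+(\gamma_0^{\mathcal S_1}\widetilde W\mu)(x_0)=\mu(x_0).$$ -/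

import Mathlib

open Filter Topology MeasureTheory Set

noncomputable section

/-- Euclidean three-space. -/
abbrev E3 : Type := EuclideanSpace ℝ (Fin 3)

/-- The unit sphere in Euclidean three-space. -/
abbrev Sphere2 : Type := Metric.sphere (0 : E3) 1

/-- The cross product on Euclidean three-space. -/
def cross (u v : E3) : E3 := WithLp.toLp 2 (crossProduct u.ofLp v.ofLp)

/-- Surface gradient at `y ∈ Sphere2` of a function given on the sphere: the Euclidean gradient of
its extension that is constant along rays, which is
`(1 / sin θ) ∂f/∂φ e_φ + ∂f/∂θ e_θ` in spherical coordinates. -/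
def surfaceGradient (f : E3 → ℝ) (y : E3) : E3 :=
  gradient (fun z : E3 => f (‖z‖⁻¹ • z)) y

/-- Vectorial surface rotation `∇_S f × e_r`, which is
`-∂f/∂θ e_φ + (1 / sin θ) ∂f/∂φ e_θ` in spherical coordinates. -/
def surfaceCurl (f : E3 → ℝ) (y : E3) : E3 :=
  cross (surfaceGradient f y) y

/-- Fundamental solution of the Laplace-Beltrami operator on the unit sphere. -/
def fundamentalSolution (x y : E3) : ℝ :=
  -(1 / (4 * Real.pi)) * Real.log |1 - inner ℝ x y|

/-- Unit tangent of a path at `s` on the side of larger parameters. -/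
def rightTangent (c : ℝ → E3) (s : ℝ) : E3 :=
  ‖derivWithin c (Ici s) s‖⁻¹ • derivWithin c (Ici s) s

/-- Unit tangent of a path at `s` on the side of smaller parameters
(pointing in the direction of increasing parameter). -/
def leftTangent (c : ℝ → E3) (s : ℝ) : E3 :=
  ‖derivWithin c (Iic s) s‖⁻¹ • derivWithin c (Iic s) s

/-- A piecewise `C²` simple closed curve on the unit sphere, made of `N ≥ 1` regular `C²` arcs (each
parametrized by an interval between consecutive integers), possibly with corners, but without
cusps. The parametrization is extended to `ℝ` with period `N`. -/
structure SphereCurve where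
  /-- The number of arcs. -/
  N : ℕ
  N_pos : 0 < N
  /-- The parametrization. -/
  pt : ℝ → Sphere2
  periodic : Function.Periodic pt (N : ℝ)
  injOn : InjOn pt (Ico 0 (N : ℝ))
  contDiffOn : ∀ k : ℤ, ContDiffOn ℝ 2 (fun s => (pt s : E3)) (Icc (k : ℝ) (k + 1))
  regular : ∀ k : ℤ, ∀ s ∈ Icc (k : ℝ) (k + 1),
    derivWithin (fun s => (pt s : E3)) (Icc (k : ℝ) (k + 1)) s ≠ 0
  no_cusp : ∀ s : ℝ,
    rightTangent (fun s => (pt s : E3)) s ≠ -leftTangent (fun s => (pt s : E3)) s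

namespace SphereCurve

/-- The parametrization as a path in Euclidean space. -/
def path (C : SphereCurve) (s : ℝ) : E3 := (C.pt s : E3)

/-- The curve as a subset of the sphere. -/
def carrier (C : SphereCurve) : Set Sphere2 := range C.pt

/-- The unit tangent vector along the curve (at a corner, that of the outgoing arc). -/
def tangent (C : SphereCurve) (s : ℝ) : E3 := rightTangent C.path s

/-- The curve divides the sphere into the two parts `S₁` and `S₂`, and it is the boundary of each
of them. -/
structure Divides (C : SphereCurve) (S₁ S₂ : Set Sphere2) : Prop where
  isOpen_fst : IsOpen S₁
  isOpen_snd : IsOpen S₂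
  disjoint : Disjoint S₁ S₂
  union_eq : S₁ ∪ S₂ = C.carrierᶜ
  frontier_fst : frontier S₁ = C.carrier
  frontier_snd : frontier S₂ = C.carrier

/-- The curve is positively oriented with respect to the region `D`, as in Stokes' theorem: seen
from outside the sphere, `D` lies to the left of the curve. At every point `y` interior to an
arc, with unit tangent `t`, the points of the sphere next to `y` in the direction `y × t`
belong to `D`. -/
def PositivelyOriented (C : SphereCurve) (D : Set Sphere2) : Prop :=
  ∀ s : ℝ, (∀ k : ℤ, s ≠ k) → ∀ᶠ δ in 𝓝[>] (0 : ℝ), ∃ z ∈ D,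
    (z : E3) = ‖C.path s + δ • cross (C.path s) (C.tangent s)‖⁻¹ •
      (C.path s + δ • cross (C.path s) (C.tangent s))

/-- The angle in `[0, 2π)` by which, at the point `x₀ = C.pt s`, the outgoing tangent direction
has to be turned to the left in the tangent plane in order to reach the reversed incoming
tangent direction. It is the interior angle of the region to the left of the curve. -/
def interiorAngle (C : SphereCurve) (s : ℝ) : ℝ :=
  toIcoMod Real.two_pi_pos 0 (Complex.arg
    ⟨inner ℝ (rightTangent C.path s) (-leftTangent C.path s),
      inner ℝ (cross (C.path s) (rightTangent C.path s)) (-leftTangent C.path s)⟩)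

/-- Line integral with respect to arc length over the part of the curve whose parameter lies in
`A`. -/
def lineIntegral (C : SphereCurve) (A : Set ℝ) (f : ℝ → ℝ) : ℝ :=
  ∫ s in Ioc 0 (C.N : ℝ) ∩ A, f s * ‖deriv C.path s‖

/-- The integrand `μ(y) [curl_S U*(x, y) · t(y)]` at `y = C.pt s`, with the surface rotation taken
in the variable `y`, for a unit tangent field `t` along the curve. -/
def doubleLayerIntegrand (C : SphereCurve) (t : ℝ → E3) (μ : Sphere2 → ℝ) (x : Sphere2)
    (s : ℝ) : ℝ :=
  μ (C.pt s) * inner ℝ (surfaceCurl (fundamentalSolution (x : E3)) (C.path s)) (t s)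

/-- The double layer potential with density `μ`, for the unit tangent field `t`. -/
def doubleLayer (C : SphereCurve) (t : ℝ → E3) (μ : Sphere2 → ℝ) (x : Sphere2) : ℝ :=
  C.lineIntegral univ (C.doubleLayerIntegrand t μ x)

/-- The truncated operator: the integral over the points of the curve at distance at least `ε`
from `x₀`. -/
def truncK (C : SphereCurve) (t : ℝ → E3) (μ : Sphere2 → ℝ) (x₀ : Sphere2) (ε : ℝ) : ℝ :=
  C.lineIntegral {s | ε ≤ ‖C.path s - (x₀ : E3)‖} (C.doubleLayerIntegrand t μ x₀)

/-- The principal value operator `K`. -/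
def K (C : SphereCurve) (t : ℝ → E3) (μ : Sphere2 → ℝ) (x₀ : Sphere2) : ℝ :=
  limUnder (𝓝[>] (0 : ℝ)) (C.truncK t μ x₀)

end SphereCurve

/-- The one-sided trace at `x₀` of a function, taken from the region `D`. -/
def trace (D : Set Sphere2) (u : Sphere2 → ℝ) (x₀ : Sphere2) : ℝ :=
  limUnder (𝓝[D] x₀) u

end

noncomputable section

/-! ### Vector algebra in Euclidean three-space -/

/-! Along a parametrization the integrand is the density times the kernel det(x, y, y') / (4π (1 -
⟨x, y⟩)). Let X and Y be the images of x and y in the stereographic chart centred at x₀. Then 2π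
times the kernel is the derivative of arg(Y - X) minus a term free of x
(`inner_cross_div_eq_stereo`). Hence the difference of the kernels at x and x₀, integrated over a
short piece of curve around x₀, is the variation of arg(Y - X) - arg Y
(`IsLocalGraph.integral_kernel_sub`). As x → x₀ the endpoint contributions reduce to ±π, the sign
depending on the side, and the corner leaves arg R - arg L, where R and L are the outgoing and
incoming tangent directions. Since α = π + arg L - arg R (`IsLocalGraph.interiorAngle_eq`), the
local jump is 1 - α/2π from the left of the curve and -α/2π from the right; these differ by 1, which
is the sum formula.

Passing from a constant to a continuous density requires a bound, uniform in x, for the integral of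
|kernel| near x₀ (`exists_kernel_majorant`). If σ is the parameter of a point of an arc nearest to
x, at distance d, the numerator is O(d + (τ - σ)²) and the denominator is at least a multiple of d²
+ (τ - σ)². A Poisson kernel plus a constant is therefore a majorant. For x on the curve this also
shows that the principal value is an absolutely convergent integral (`tendsto_truncK`).

The sides are identified in `IsLocalGraph.eventually_sides`. Absence of cusps yields a direction
along which both one-sided tangents advance, so the curve is locally a graph in the chart. The thin
strips above and below the graph are connected and miss the curve, so each lies in one region; the
orientation puts the upper strip in S₂, and the frontier condition then puts the lower one in S₁.
The Jordan curve theorem is not used. -/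

theorem cross_ofLp_zero (u v : E3) : cross u v 0 = u 1 * v 2 - u 2 * v 1 := by
  simp [cross, cross_apply]

theorem cross_ofLp_one (u v : E3) : cross u v 1 = u 2 * v 0 - u 0 * v 2 := by
  simp [cross, cross_apply]

theorem cross_ofLp_two (u v : E3) : cross u v 2 = u 0 * v 1 - u 1 * v 0 := by
  simp [cross, cross_apply]

theorem inner_E3 (u v : E3) : inner ℝ u v = u 0 * v 0 + u 1 * v 1 + u 2 * v 2 := by
  simp [PiLp.inner_apply, Fin.sum_univ_three]
  ring

theorem inner_cross (u v w : E3) : inner ℝ (cross u v) w =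
    (u 1 * v 2 - u 2 * v 1) * w 0 + (u 2 * v 0 - u 0 * v 2) * w 1 +
      (u 0 * v 1 - u 1 * v 0) * w 2 := by
  rw [inner_E3, cross_ofLp_zero, cross_ofLp_one, cross_ofLp_two]

theorem inner_cross_cyclic (u v w : E3) : inner ℝ (cross u v) w = inner ℝ (cross v w) u := by
  rw [inner_cross, inner_cross]; ring

theorem inner_cross_left_self (u v : E3) : inner ℝ (cross u v) u = 0 := by
  rw [inner_cross]; ring

theorem inner_cross_right_self (u v : E3) : inner ℝ (cross u v) v = 0 := by
  rw [inner_cross]; ring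

theorem inner_cross_self (u w : E3) : inner ℝ (cross u u) w = 0 := by
  rw [inner_cross]; ring

theorem inner_cross_sub_left (u u' v w : E3) :
    inner ℝ (cross (u - u') v) w = inner ℝ (cross u v) w - inner ℝ (cross u' v) w := by
  simp only [inner_cross, PiLp.sub_apply]; ring

theorem inner_cross_smul_left (c : ℝ) (u v w : E3) :
    inner ℝ (cross (c • u) v) w = c * inner ℝ (cross u v) w := by
  simp only [inner_cross, PiLp.smul_apply, smul_eq_mul]; ring

theorem inner_cross_cross (u v w z : E3) : inner ℝ (cross u v) (cross w z) =
    inner ℝ u w * inner ℝ v z - inner ℝ u z * inner ℝ v w := by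
  simp only [inner_E3, cross_ofLp_zero, cross_ofLp_one, cross_ofLp_two]; ring

theorem norm_cross_le (u v : E3) : ‖cross u v‖ ≤ ‖u‖ * ‖v‖ := by
  refine le_of_sq_le_sq ?_ (by positivity)
  rw [← real_inner_self_eq_norm_sq, inner_cross_cross, mul_pow, ← real_inner_self_eq_norm_sq,
    ← real_inner_self_eq_norm_sq, real_inner_comm u v]
  nlinarith [sq_nonneg (inner ℝ u v)]

theorem abs_inner_cross_le (u v w : E3) : |inner ℝ (cross u v) w| ≤ ‖u‖ * ‖v‖ * ‖w‖ :=
  (abs_real_inner_le_norm _ _).trans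
    (mul_le_mul_of_nonneg_right (norm_cross_le u v) (norm_nonneg w))

theorem continuous_cross : Continuous fun p : E3 × E3 => cross p.1 p.2 := by
  unfold cross
  refine (PiLp.continuous_toLp 2 _).comp ?_
  refine continuous_pi fun i => ?_
  fin_cases i <;> simp [cross_apply] <;> fun_prop

/-- Distance and inner product of two unit vectors. -/
theorem norm_sub_sq_of_unit {x y : E3} (hx : ‖x‖ = 1) (hy : ‖y‖ = 1) :
    ‖x - y‖ ^ 2 = 2 * (1 - inner ℝ x y) := by
  rw [norm_sub_sq_real, hx, hy]; ring

/-- Coordinates with respect to the orthonormal frame `(a, c × a, c)`. -/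
theorem frame_decomposition {a c : E3} (ha : ‖a‖ = 1) (hc : ‖c‖ = 1) (hac : inner ℝ c a = 0)
    (y : E3) : y = inner ℝ y a • a + inner ℝ y (cross c a) • cross c a + inner ℝ y c • c := by
  have haa : inner ℝ a a = 1 := by rw [real_inner_self_eq_norm_sq, ha]; norm_num
  have hcc : inner ℝ c c = 1 := by rw [real_inner_self_eq_norm_sq, hc]; norm_num
  have hac' : inner ℝ a c = 0 := by rw [real_inner_comm]; exact hac
  have hbb : inner ℝ (cross c a) (cross c a) = 1 := by
    rw [inner_cross_cross, haa, hcc, hac]; ring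
  have hb : ‖cross c a‖ = 1 := by
    rw [real_inner_self_eq_norm_sq] at hbb
    nlinarith [norm_nonneg (cross c a)]
  have ho : Orthonormal ℝ ![a, cross c a, c] := by
    constructor
    · intro i; fin_cases i <;> simp [ha, hb, hc]
    · intro i j hij
      fin_cases i <;> fin_cases j <;>
        simp [hac, hac', inner_cross_left_self, inner_cross_right_self,
          real_inner_comm (cross c a)] at hij ⊢
  have hcard : Fintype.card (Fin 3) = Module.finrank ℝ E3 := by simp
  let B := (basisOfOrthonormalOfCardEqFinrank ho hcard).toOrthonormalBasis (by
    rw [coe_basisOfOrthonormalOfCardEqFinrank]; exact ho)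
  have hB : ⇑B = ![a, cross c a, c] := by simp [B]
  have := B.sum_repr' y
  rw [Fin.sum_univ_three] at this
  simp only [hB] at this
  simp only [Matrix.cons_val_zero, Matrix.cons_val_one, Matrix.cons_val_two, Matrix.head_cons,
    Matrix.tail_cons] at this
  rw [real_inner_comm a y, real_inner_comm (cross c a) y, real_inner_comm c y]
  exact this.symm

theorem inner_eq_frame {a c : E3} (ha : ‖a‖ = 1) (hc : ‖c‖ = 1) (hac : inner ℝ c a = 0) (x y : E3) :
    inner ℝ x y = inner ℝ x a * inner ℝ y a +
      inner ℝ x (cross c a) * inner ℝ y (cross c a) + inner ℝ x c * inner ℝ y c := by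
  conv_lhs => rw [frame_decomposition ha hc hac y]
  simp only [inner_add_right, inner_smul_right]
  ring

/-- The frame `(a, c × a, c)` is orthonormal and positively oriented, so the triple product is the
determinant of the coordinates in it. -/
theorem inner_cross_eq_frame {a c : E3} (ha : ‖a‖ = 1) (hc : ‖c‖ = 1) (hac : inner ℝ c a = 0)
    (x y z : E3) : inner ℝ (cross x y) z =
      inner ℝ x a * (inner ℝ y (cross c a) * inner ℝ z c - inner ℝ y c * inner ℝ z (cross c a)) +
      inner ℝ x (cross c a) * (inner ℝ y c * inner ℝ z a - inner ℝ y a * inner ℝ z c) +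
      inner ℝ x c * (inner ℝ y a * inner ℝ z (cross c a) -
        inner ℝ y (cross c a) * inner ℝ z a) := by
  have haa : inner ℝ a a = 1 := by rw [real_inner_self_eq_norm_sq, ha]; norm_num
  have hcc : inner ℝ c c = 1 := by rw [real_inner_self_eq_norm_sq, hc]; norm_num
  have h1 (w : E3) : inner ℝ (cross a (cross c a)) w = inner ℝ w c := by
    rw [inner_cross_cyclic, inner_cross_cyclic, inner_cross_cross, haa, real_inner_comm c a, hac]
    ring
  have h2 (w : E3) : inner ℝ (cross (cross c a) c) w = inner ℝ w a := by
    rw [inner_cross_cyclic, inner_cross_cross, hcc, hac]; ring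
  have key : inner ℝ (cross x y) z =
      inner ℝ (cross (inner ℝ x a • a + inner ℝ x (cross c a) • cross c a + inner ℝ x c • c)
        (inner ℝ y a • a + inner ℝ y (cross c a) • cross c a + inner ℝ y c • c)) z := by
    rw [← frame_decomposition ha hc hac, ← frame_decomposition ha hc hac]
  rw [key]
  have e (p q r p' q' r' : ℝ) (u v w : E3) : inner ℝ (cross (p • u + q • v + r • w)
      (p' • u + q' • v + r' • w)) z = (p * q' - q * p') * inner ℝ (cross u v) z +
      (q * r' - r * q') * inner ℝ (cross v w) z + (r * p' - p * r') * inner ℝ (cross w u) z := by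
    simp only [inner_cross, PiLp.add_apply, PiLp.smul_apply, smul_eq_mul]; ring
  rw [e, h1, h2, real_inner_comm z (cross c a)]
  ring

/-! ### The kernel of the double layer potential -/

theorem hasGradientAt_fundamentalSolution_radial {x y : E3} (hy : ‖y‖ = 1)
    (hxy : inner ℝ x y ≠ 1) :
    HasGradientAt (fun z : E3 => fundamentalSolution x (‖z‖⁻¹ • z))
      ((1 / (4 * Real.pi) * (1 - inner ℝ x y)⁻¹) • (x - inner ℝ x y • y)) y := by
  have hne : 1 - inner ℝ x y ≠ 0 := sub_ne_zero.mpr (Ne.symm hxy)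
  have hsq : HasFDerivAt (fun z : E3 => ‖z‖ ^ 2) ((2 : ℝ) • innerSL ℝ y) y := by
    refine (hasStrictFDerivAt_norm_sq y).hasFDerivAt.congr_fderiv ?_
    ext v; simp
  -- Writing the norm as the root of the squared norm lets the chain rule run through a polynomial;
  -- `heq` below returns to the norm and removes the absolute value inside the logarithm.
  have hn : HasFDerivAt (fun z : E3 => √(‖z‖ ^ 2))
      ((1 / (2 * √(‖y‖ ^ 2))) • ((2 : ℝ) • innerSL ℝ y)) y := hsq.sqrt (by simp [hy])
  have hi : HasFDerivAt (fun z : E3 => (√(‖z‖ ^ 2))⁻¹) (-innerSL ℝ y) y := by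
    have := (hasDerivAt_inv (x := √(‖y‖ ^ 2)) (by simp [hy])).comp_hasFDerivAt y hn
    refine this.congr_fderiv ?_
    ext v; simp [hy]
  have hx : HasFDerivAt (fun z : E3 => inner ℝ x z) (innerSL ℝ x) y := (innerSL ℝ x).hasFDerivAt
  have hf := (hi.mul hx)
  have hl := ((hf.const_sub 1).log (by simpa [hy] using hne)).const_mul (-(1 / (4 * Real.pi)))
  rw [hasGradientAt_iff_hasFDerivAt]
  have heq : (fun z : E3 => fundamentalSolution x (‖z‖⁻¹ • z)) = fun z : E3 =>
      -(1 / (4 * Real.pi)) * Real.log (1 - (√(‖z‖ ^ 2))⁻¹ * inner ℝ x z) := by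
    funext z
    simp only [fundamentalSolution, inner_smul_right, Real.log_abs, Real.sqrt_sq (norm_nonneg z)]
  rw [heq]
  refine hl.congr_fderiv ?_
  ext v
  simp [hy]
  ring

/-- The gradient is a multiple of the tangential part of `x`, and the subtracted multiple of `y`
dies in the cross product with `y`. -/
theorem inner_surfaceCurl_fundamentalSolution {x y : E3} (hy : ‖y‖ = 1)
    (hxy : inner ℝ x y ≠ 1) (t : E3) :
    inner ℝ (surfaceCurl (fundamentalSolution x) y) t =
      1 / (4 * Real.pi) * (inner ℝ (cross x y) t / (1 - inner ℝ x y)) := by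
  rw [surfaceCurl, surfaceGradient, (hasGradientAt_fundamentalSolution_radial hy hxy).gradient,
    inner_cross_smul_left, inner_cross_sub_left, inner_cross_smul_left, inner_cross_self]
  ring

namespace SphereCurve

variable (C : SphereCurve)

/-! ### Regularity of the parametrization -/

theorem norm_path (s : ℝ) : ‖C.path s‖ = 1 := by
  simp [path]

theorem periodic_path : Function.Periodic C.path (C.N : ℝ) := fun s => by
  simp only [path, C.periodic s]

theorem periodic_deriv_path : Function.Periodic (deriv C.path) (C.N : ℝ) := fun s => by
  rw [← deriv_comp_add_const]
  congr 1
  exact funext C.periodic_path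

theorem contDiffOn_path (k : ℤ) : ContDiffOn ℝ 2 C.path (Icc (k : ℝ) (k + 1)) := C.contDiffOn k

theorem hasDerivWithinAt_arc {k : ℤ} {τ : ℝ} (hτ : τ ∈ Icc (k : ℝ) (k + 1)) :
    HasDerivWithinAt C.path (derivWithin C.path (Icc (k : ℝ) (k + 1)) τ) (Icc (k : ℝ) (k + 1)) τ :=
  ((C.contDiffOn_path k).differentiableOn (by norm_num) τ hτ).hasDerivWithinAt

theorem hasDerivAt_arc {k : ℤ} {τ : ℝ} (hτ : τ ∈ Ioo (k : ℝ) (k + 1)) :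
    HasDerivAt C.path (derivWithin C.path (Icc (k : ℝ) (k + 1)) τ) τ :=
  (C.hasDerivWithinAt_arc (Ioo_subset_Icc_self hτ)).hasDerivAt (Icc_mem_nhds hτ.1 hτ.2)

theorem contDiffOn_derivWithin_arc (k : ℤ) :
    ContDiffOn ℝ 1 (derivWithin C.path (Icc (k : ℝ) (k + 1))) (Icc (k : ℝ) (k + 1)) :=
  (C.contDiffOn_path k).derivWithin (uniqueDiffOn_Icc (by linarith)) (by norm_num)

/-- On a closed arc the second derivative is bounded by compactness, so the first is Lipschitz. The
mean value inequality for `C.path ρ - (ρ - τ) • D τ` then gives the quadratic remainder; the sharp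
factor 1/2 is not needed. -/
theorem norm_taylor_arc_le (k : ℤ) : ∃ M : ℝ, 0 ≤ M ∧
    ∀ τ ∈ Icc (k : ℝ) (k + 1), ∀ σ ∈ Icc (k : ℝ) (k + 1),
      ‖C.path σ - C.path τ - (σ - τ) • derivWithin C.path (Icc (k : ℝ) (k + 1)) τ‖ ≤
        M * (σ - τ) ^ 2 := by
  set D := derivWithin C.path (Icc (k : ℝ) (k + 1)) with hD
  have hu : UniqueDiffOn ℝ (Icc (k : ℝ) (k + 1)) := uniqueDiffOn_Icc (by linarith)
  have hc : ContinuousOn (derivWithin D (Icc (k : ℝ) (k + 1))) (Icc (k : ℝ) (k + 1)) :=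
    (C.contDiffOn_derivWithin_arc k).continuousOn_derivWithin hu le_rfl
  obtain ⟨M, hM⟩ := isCompact_Icc.exists_bound_of_continuousOn hc
  have hM0 : 0 ≤ M := (norm_nonneg _).trans (hM k ⟨le_rfl, by linarith⟩)
  have hlip : ∀ τ ∈ Icc (k : ℝ) (k + 1), ∀ σ ∈ Icc (k : ℝ) (k + 1),
      ‖D σ - D τ‖ ≤ M * ‖σ - τ‖ := fun τ hτ σ hσ =>
    (convex_Icc (k : ℝ) (k + 1)).norm_image_sub_le_of_norm_derivWithin_le
      ((C.contDiffOn_derivWithin_arc k).differentiableOn (by norm_num)) hM hτ hσ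
  refine ⟨M, hM0, fun τ hτ σ hσ => ?_⟩
  have hsub : uIcc τ σ ⊆ Icc (k : ℝ) (k + 1) := (convex_Icc _ _).ordConnected.uIcc_subset hτ hσ
  have hder : ∀ ρ ∈ uIcc τ σ, HasDerivWithinAt (fun ρ => C.path ρ - (ρ - τ) • D τ)
      (D ρ - D τ) (uIcc τ σ) ρ := by
    intro ρ hρ
    have h1 := (C.hasDerivWithinAt_arc (hsub hρ)).mono hsub
    have h2 : HasDerivWithinAt (fun ρ : ℝ => (ρ - τ) • D τ) ((1 : ℝ) • D τ) (uIcc τ σ) ρ :=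
      ((hasDerivWithinAt_id ρ _).sub_const τ).smul_const (D τ)
    rw [one_smul] at h2
    exact h1.sub h2
  have hb : ∀ ρ ∈ uIcc τ σ, ‖D ρ - D τ‖ ≤ M * |σ - τ| := by
    intro ρ hρ
    refine (hlip τ hτ ρ (hsub hρ)).trans ?_
    refine mul_le_mul_of_nonneg_left ?_ hM0
    rw [Real.norm_eq_abs]
    exact abs_sub_left_of_mem_uIcc hρ
  have := (convex_uIcc τ σ).norm_image_sub_le_of_norm_hasDerivWithin_le hder hb
    left_mem_uIcc right_mem_uIcc
  have h3 : C.path σ - (σ - τ) • D τ - (C.path τ - (τ - τ) • D τ) =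
      C.path σ - C.path τ - (σ - τ) • D τ := by
    rw [sub_self, zero_smul]; abel
  rw [h3, Real.norm_eq_abs, mul_assoc, ← sq, sq_abs] at this
  exact this

/-- The one-sided derivative on the side of larger parameters. -/
def rightDeriv (s : ℝ) : E3 := derivWithin C.path (Ici s) s

/-- The one-sided derivative on the side of smaller parameters. -/
def leftDeriv (s : ℝ) : E3 := derivWithin C.path (Iic s) s

/-- The interval of an arc is a right neighbourhood of each of its points except the last. At an
integer this selects the arc that begins there. -/
theorem rightDeriv_eq {k : ℤ} {s : ℝ} (hs : s ∈ Ico (k : ℝ) (k + 1)) :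
    C.rightDeriv s = derivWithin C.path (Icc (k : ℝ) (k + 1)) s := by
  have h : HasDerivWithinAt C.path (derivWithin C.path (Icc (k : ℝ) (k + 1)) s) (Ici s) s := by
    have := (C.hasDerivWithinAt_arc (Ico_subset_Icc_self hs)).mono (Icc_subset_Icc_left hs.1)
    exact this.mono_of_mem_nhdsWithin (Icc_mem_nhdsGE hs.2)
  exact h.derivWithin (uniqueDiffOn_Ici s s self_mem_Ici)

theorem leftDeriv_eq {k : ℤ} {s : ℝ} (hs : s ∈ Ioc (k : ℝ) (k + 1)) :
    C.leftDeriv s = derivWithin C.path (Icc (k : ℝ) (k + 1)) s := by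
  have h : HasDerivWithinAt C.path (derivWithin C.path (Icc (k : ℝ) (k + 1)) s) (Iic s) s := by
    have := (C.hasDerivWithinAt_arc (Ioc_subset_Icc_self hs)).mono (Icc_subset_Icc_right hs.2)
    exact this.mono_of_mem_nhdsWithin (Icc_mem_nhdsLE hs.1)
  exact h.derivWithin (uniqueDiffOn_Iic s s self_mem_Iic)

theorem exists_mem_Ico (s : ℝ) : ∃ k : ℤ, s ∈ Ico (k : ℝ) (k + 1) :=
  ⟨⌊s⌋, Int.floor_le s, Int.lt_floor_add_one s⟩

theorem exists_mem_Ioc (s : ℝ) : ∃ k : ℤ, s ∈ Ioc (k : ℝ) (k + 1) :=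
  ⟨⌈s⌉ - 1, by push_cast; linarith [Int.ceil_lt_add_one s], by push_cast; linarith [Int.le_ceil s]⟩

theorem rightDeriv_ne_zero (s : ℝ) : C.rightDeriv s ≠ 0 := by
  obtain ⟨k, hk⟩ := exists_mem_Ico s
  rw [C.rightDeriv_eq hk]
  exact C.regular k s (Ico_subset_Icc_self hk)

theorem leftDeriv_ne_zero (s : ℝ) : C.leftDeriv s ≠ 0 := by
  obtain ⟨k, hk⟩ := exists_mem_Ioc s
  rw [C.leftDeriv_eq hk]
  exact C.regular k s (Ioc_subset_Icc_self hk)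

theorem hasDerivWithinAt_rightDeriv (s : ℝ) :
    HasDerivWithinAt C.path (C.rightDeriv s) (Ici s) s := by
  obtain ⟨k, hk⟩ := exists_mem_Ico s
  rw [C.rightDeriv_eq hk]
  have := (C.hasDerivWithinAt_arc (Ico_subset_Icc_self hk)).mono (Icc_subset_Icc_left hk.1)
  exact this.mono_of_mem_nhdsWithin (Icc_mem_nhdsGE hk.2)

theorem hasDerivWithinAt_leftDeriv (s : ℝ) :
    HasDerivWithinAt C.path (C.leftDeriv s) (Iic s) s := by
  obtain ⟨k, hk⟩ := exists_mem_Ioc s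
  rw [C.leftDeriv_eq hk]
  have := (C.hasDerivWithinAt_arc (Ioc_subset_Icc_self hk)).mono (Icc_subset_Icc_right hk.2)
  exact this.mono_of_mem_nhdsWithin (Icc_mem_nhdsLE hk.1)

theorem continuous_path : Continuous C.path := by
  refine continuous_iff_continuousAt.2 fun s => ?_
  exact continuousAt_iff_continuous_left_right.2
    ⟨(C.hasDerivWithinAt_leftDeriv s).continuousWithinAt,
      (C.hasDerivWithinAt_rightDeriv s).continuousWithinAt⟩

theorem continuous_pt : Continuous C.pt := continuous_induced_rng.2 C.continuous_path

/-- The derivative within an arc is continuous up to the endpoints and equals `deriv` in the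
interior. The limit therefore exists even at a corner, where `deriv` itself has the default value
`0`. -/
theorem tendsto_deriv_right (s : ℝ) :
    Tendsto (deriv C.path) (𝓝[>] s) (𝓝 (C.rightDeriv s)) := by
  obtain ⟨k, hk⟩ := exists_mem_Ico s
  rw [C.rightDeriv_eq hk]
  have h := (C.contDiffOn_derivWithin_arc k).continuousOn s (Ico_subset_Icc_self hk)
  have h' : Tendsto (derivWithin C.path (Icc (k : ℝ) (k + 1))) (𝓝[Ioo s (k + 1)] s)
      (𝓝 (derivWithin C.path (Icc (k : ℝ) (k + 1)) s)) :=
    h.mono_left (nhdsWithin_mono _ fun τ hτ => ⟨hk.1.trans hτ.1.le, hτ.2.le⟩)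
  rw [← nhdsWithin_Ioo_eq_nhdsGT hk.2]
  refine h'.congr' ?_
  filter_upwards [self_mem_nhdsWithin] with τ hτ
  exact (C.hasDerivAt_arc ⟨hk.1.trans_lt hτ.1, hτ.2⟩).deriv.symm

theorem tendsto_deriv_left (s : ℝ) :
    Tendsto (deriv C.path) (𝓝[<] s) (𝓝 (C.leftDeriv s)) := by
  obtain ⟨k, hk⟩ := exists_mem_Ioc s
  rw [C.leftDeriv_eq hk]
  have h := (C.contDiffOn_derivWithin_arc k).continuousOn s (Ioc_subset_Icc_self hk)
  have h' : Tendsto (derivWithin C.path (Icc (k : ℝ) (k + 1))) (𝓝[Ioo (k : ℝ) s] s)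
      (𝓝 (derivWithin C.path (Icc (k : ℝ) (k + 1)) s)) :=
    h.mono_left (nhdsWithin_mono _ fun τ hτ => ⟨hτ.1.le, hτ.2.le.trans hk.2⟩)
  rw [← nhdsWithin_Ioo_eq_nhdsLT hk.1]
  refine h'.congr' ?_
  filter_upwards [self_mem_nhdsWithin] with τ hτ
  exact (C.hasDerivAt_arc ⟨hτ.1, hτ.2.trans_le hk.2⟩).deriv.symm

/-- By periodicity finitely many compact arcs suffice. At points of non-differentiability `deriv` is
`0` by default and obeys the bound trivially. -/
theorem exists_norm_deriv_le : ∃ M : ℝ, 0 ≤ M ∧ ∀ s, ‖deriv C.path s‖ ≤ M := by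
  have h (k : ℤ) : ∃ M, ∀ s ∈ Icc (k : ℝ) (k + 1),
      ‖derivWithin C.path (Icc (k : ℝ) (k + 1)) s‖ ≤ M :=
    isCompact_Icc.exists_bound_of_continuousOn (C.contDiffOn_derivWithin_arc k).continuousOn
  choose M hM using h
  have hM0 (k : ℤ) : 0 ≤ M k := (norm_nonneg _).trans (hM k k ⟨le_rfl, by linarith⟩)
  have hN : (0 : ℝ) < C.N := by exact_mod_cast C.N_pos
  refine ⟨∑ k ∈ Finset.range C.N, M k, Finset.sum_nonneg fun k _ => hM0 k, fun s => ?_⟩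
  obtain ⟨σ, hσ, hσs⟩ := C.periodic_deriv_path.exists_mem_Ico₀ hN s
  rw [hσs]
  by_cases hd : DifferentiableAt ℝ C.path σ
  · have hk : σ ∈ Ico ((⌊σ⌋ : ℤ) : ℝ) (⌊σ⌋ + 1) := ⟨Int.floor_le σ, Int.lt_floor_add_one σ⟩
    have hfl : 0 ≤ ⌊σ⌋ := Int.floor_nonneg.2 hσ.1
    have e : deriv C.path σ = derivWithin C.path (Icc ((⌊σ⌋ : ℤ) : ℝ) (⌊σ⌋ + 1)) σ :=
      (hd.derivWithin (uniqueDiffOn_Icc (by linarith) σ (Ico_subset_Icc_self hk))).symm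
    rw [e]
    refine (hM _ σ (Ico_subset_Icc_self hk)).trans ?_
    have hmem : ⌊σ⌋.toNat ∈ Finset.range C.N := by
      rw [Finset.mem_range]
      have : (⌊σ⌋ : ℝ) < C.N := hk.1.trans_lt hσ.2
      have : ⌊σ⌋ < C.N := by exact_mod_cast this
      omega
    have := Finset.single_le_sum (f := fun k : ℕ => M k) (fun k _ => hM0 k) hmem
    simpa [Int.toNat_of_nonneg hfl] using this
  · rw [deriv_zero_of_not_differentiableAt hd, norm_zero]
    exact Finset.sum_nonneg fun k _ => hM0 k

theorem inner_path_deriv (s : ℝ) : inner ℝ (C.path s) (deriv C.path s) = 0 := by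
  by_cases hd : DifferentiableAt ℝ C.path s
  · have h := hd.hasDerivAt.norm_sq
    have h1 : HasDerivAt (fun τ => ‖C.path τ‖ ^ 2) 0 s := by
      simp only [C.norm_path]; exact hasDerivAt_const _ _
    have := h.unique h1
    linarith
  · rw [deriv_zero_of_not_differentiableAt hd, inner_zero_right]

theorem inner_path_rightDeriv (s : ℝ) : inner ℝ (C.path s) (C.rightDeriv s) = 0 := by
  have h1 : Tendsto (fun τ => inner ℝ (C.path τ) (deriv C.path τ)) (𝓝[>] s)
      (𝓝 (inner ℝ (C.path s) (C.rightDeriv s))) :=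
    (C.continuous_path.continuousAt.tendsto.mono_left nhdsWithin_le_nhds).inner
      (C.tendsto_deriv_right s)
  simp only [C.inner_path_deriv] at h1
  exact tendsto_nhds_unique h1 tendsto_const_nhds

theorem inner_path_leftDeriv (s : ℝ) : inner ℝ (C.path s) (C.leftDeriv s) = 0 := by
  have h1 : Tendsto (fun τ => inner ℝ (C.path τ) (deriv C.path τ)) (𝓝[<] s)
      (𝓝 (inner ℝ (C.path s) (C.leftDeriv s))) :=
    (C.continuous_path.continuousAt.tendsto.mono_left nhdsWithin_le_nhds).inner
      (C.tendsto_deriv_left s)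
  simp only [C.inner_path_deriv] at h1
  exact tendsto_nhds_unique h1 tendsto_const_nhds

theorem rightTangent_eq (s : ℝ) :
    rightTangent C.path s = ‖C.rightDeriv s‖⁻¹ • C.rightDeriv s := rfl

theorem leftTangent_eq (s : ℝ) :
    leftTangent C.path s = ‖C.leftDeriv s‖⁻¹ • C.leftDeriv s := rfl

theorem norm_rightTangent (s : ℝ) : ‖rightTangent C.path s‖ = 1 := by
  rw [rightTangent_eq, norm_smul, norm_inv, norm_norm,
    inv_mul_cancel₀ (norm_ne_zero_iff.2 (C.rightDeriv_ne_zero s))]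

theorem norm_leftTangent (s : ℝ) : ‖leftTangent C.path s‖ = 1 := by
  rw [leftTangent_eq, norm_smul, norm_inv, norm_norm,
    inv_mul_cancel₀ (norm_ne_zero_iff.2 (C.leftDeriv_ne_zero s))]

/-- A unit vector, tangent to the sphere, along which both one-sided derivatives advance. -/
theorem exists_transversal (s : ℝ) : ∃ a : E3, ‖a‖ = 1 ∧ inner ℝ (C.path s) a = 0 ∧
    0 < inner ℝ (C.rightDeriv s) a ∧ 0 < inner ℝ (C.leftDeriv s) a := by
  set p := rightTangent C.path s with hp
  set q := leftTangent C.path s with hq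
  -- The vector sought is the normalized bisector of the two unit tangents. It exists exactly
  -- because there is no cusp, and ‖p + q‖ > 0 also forces ⟨p, q⟩ > -1, which makes both components
  -- positive.
  have hne : p + q ≠ 0 := fun h => C.no_cusp s (eq_neg_of_add_eq_zero_left h)
  have hpp : ‖p‖ = 1 := C.norm_rightTangent s
  have hqq : ‖q‖ = 1 := C.norm_leftTangent s
  have hpos : 0 < ‖p + q‖ := norm_pos_iff.2 hne
  have h1 : 0 < 1 + inner ℝ p q := by
    have : ‖p + q‖ ^ 2 = 2 * (1 + inner ℝ p q) := by rw [norm_add_sq_real, hpp, hqq]; ring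
    nlinarith
  have hxp : inner ℝ (C.path s) p = 0 := by
    rw [hp, rightTangent_eq, inner_smul_right, C.inner_path_rightDeriv, mul_zero]
  have hxq : inner ℝ (C.path s) q = 0 := by
    rw [hq, leftTangent_eq, inner_smul_right, C.inner_path_leftDeriv, mul_zero]
  have hR : C.rightDeriv s = ‖C.rightDeriv s‖ • p := by
    rw [hp, rightTangent_eq, smul_smul,
      mul_inv_cancel₀ (norm_ne_zero_iff.2 (C.rightDeriv_ne_zero s)), one_smul]
  have hL : C.leftDeriv s = ‖C.leftDeriv s‖ • q := by
    rw [hq, leftTangent_eq, smul_smul,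
      mul_inv_cancel₀ (norm_ne_zero_iff.2 (C.leftDeriv_ne_zero s)), one_smul]
  have hR0 := norm_pos_iff.2 (C.rightDeriv_ne_zero s)
  have hL0 := norm_pos_iff.2 (C.leftDeriv_ne_zero s)
  refine ⟨‖p + q‖⁻¹ • (p + q), ?_, ?_, ?_, ?_⟩
  · rw [norm_smul, norm_inv, norm_norm, inv_mul_cancel₀ hpos.ne']
  · rw [inner_smul_right, inner_add_right, hxp, hxq]; ring
  · rw [hR, inner_smul_left, inner_smul_right, inner_add_right, real_inner_self_eq_norm_sq, hpp]
    simp only [conj_trivial]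
    rw [one_pow]
    positivity
  · rw [hL, inner_smul_left, inner_smul_right, inner_add_right, real_inner_self_eq_norm_sq, hqq,
      real_inner_comm p q]
    simp only [conj_trivial]
    exact mul_pos hL0 (mul_pos (inv_pos.2 hpos) (by linarith))

/-- Here `τ` stays off the corner, so that `deriv` is the true derivative, while `σ` may be the
corner itself. -/
theorem eventually_taylor_right (s : ℝ) : ∃ M : ℝ, 0 ≤ M ∧ ∃ η₀ > 0,
    (∀ τ ∈ Ioo s (s + η₀), DifferentiableAt ℝ C.path τ) ∧
    ∀ τ ∈ Ioo s (s + η₀), ∀ σ ∈ Icc s (s + η₀),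
      ‖C.path σ - C.path τ - (σ - τ) • deriv C.path τ‖ ≤ M * (σ - τ) ^ 2 := by
  obtain ⟨k, hk⟩ := exists_mem_Ico s
  obtain ⟨M, hM0, hM⟩ := C.norm_taylor_arc_le k
  refine ⟨M, hM0, k + 1 - s, by linarith [hk.2], ?_, ?_⟩
  · intro τ hτ
    exact (C.hasDerivAt_arc ⟨hk.1.trans_lt hτ.1, by linarith [hτ.2]⟩).differentiableAt
  · intro τ hτ σ hσ
    have hτ' : τ ∈ Ioo (k : ℝ) (k + 1) := ⟨hk.1.trans_lt hτ.1, by linarith [hτ.2]⟩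
    rw [(C.hasDerivAt_arc hτ').deriv]
    exact hM τ (Ioo_subset_Icc_self hτ') σ ⟨hk.1.trans hσ.1, by linarith [hσ.2]⟩

theorem eventually_taylor_left (s : ℝ) : ∃ M : ℝ, 0 ≤ M ∧ ∃ η₀ > 0,
    (∀ τ ∈ Ioo (s - η₀) s, DifferentiableAt ℝ C.path τ) ∧
    ∀ τ ∈ Ioo (s - η₀) s, ∀ σ ∈ Icc (s - η₀) s,
      ‖C.path σ - C.path τ - (σ - τ) • deriv C.path τ‖ ≤ M * (σ - τ) ^ 2 := by
  obtain ⟨k, hk⟩ := exists_mem_Ioc s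
  obtain ⟨M, hM0, hM⟩ := C.norm_taylor_arc_le k
  refine ⟨M, hM0, s - k, by linarith [hk.1], ?_, ?_⟩
  · intro τ hτ
    exact (C.hasDerivAt_arc ⟨by linarith [hτ.1], hτ.2.trans_le hk.2⟩).differentiableAt
  · intro τ hτ σ hσ
    have hτ' : τ ∈ Ioo (k : ℝ) (k + 1) := ⟨by linarith [hτ.1], hτ.2.trans_le hk.2⟩
    rw [(C.hasDerivAt_arc hτ').deriv]
    exact hM τ (Ioo_subset_Icc_self hτ') σ ⟨by linarith [hσ.1], hσ.2.trans hk.2⟩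

end SphereCurve

/-! ### Uniform integrable majorants of the kernel -/

/-- The Poisson-type integral is bounded independently of the parameters. -/
theorem integral_poisson_le {d l : ℝ} (hd : 0 ≤ d) (hl : 0 < l) (σ A B : ℝ) :
    IntervalIntegrable (fun τ => d / (d ^ 2 + l ^ 2 * (τ - σ) ^ 2)) volume A B ∧
      ∫ τ in A..B, d / (d ^ 2 + l ^ 2 * (τ - σ) ^ 2) ≤ Real.pi / l := by
  rcases hd.eq_or_lt with rfl | hd
  -- For `d = 0` the integrand is identically zero, also at `τ = σ` where it reads `0 / 0`.
  · simp only [zero_div, intervalIntegral.integral_zero]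
    exact ⟨intervalIntegrable_const, by positivity⟩
  have hpos (τ : ℝ) : 0 < d ^ 2 + l ^ 2 * (τ - σ) ^ 2 := by positivity
  have hc : Continuous fun τ => d / (d ^ 2 + l ^ 2 * (τ - σ) ^ 2) :=
    continuous_const.div (by fun_prop) fun τ => (hpos τ).ne'
  refine ⟨hc.intervalIntegrable _ _, ?_⟩
  -- The total variation of this primitive is below π / l whatever `d` is; this is the source of the
  -- uniformity in `x`.
  have hder (τ : ℝ) : HasDerivAt (fun τ => Real.arctan (l * (τ - σ) / d) / l)
      (d / (d ^ 2 + l ^ 2 * (τ - σ) ^ 2)) τ := by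
    have h1 : HasDerivAt (fun τ => l * (τ - σ) / d) (l * 1 / d) τ :=
      (((hasDerivAt_id τ).sub_const σ).const_mul l).div_const d
    refine ((h1.arctan).div_const l).congr_deriv ?_
    have := (hpos τ).ne'
    field_simp
  rw [intervalIntegral.integral_eq_sub_of_hasDerivAt (fun τ _ => hder τ)
    (hc.intervalIntegrable _ _), ← sub_div]
  gcongr
  linarith [Real.arctan_lt_pi_div_two (l * (B - σ) / d),
    Real.neg_pi_div_two_lt_arctan (l * (A - σ) / d)]

namespace SphereCurve

variable (C : SphereCurve)

/-- The kernel of the double layer potential, including the arc length factor. -/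
def kernel (x : E3) (s : ℝ) : ℝ :=
  1 / (4 * Real.pi) * (inner ℝ (cross x (C.path s)) (deriv C.path s) / (1 - inner ℝ x (C.path s)))

/-- Where the path is not differentiable both sides vanish, `deriv` being `0`, so no exceptional set
of corners has to be removed. -/
theorem norm_deriv_smul_tangent (s : ℝ) : ‖deriv C.path s‖ • C.tangent s = deriv C.path s := by
  by_cases hd : DifferentiableAt ℝ C.path s
  · have h : derivWithin C.path (Ici s) s = deriv C.path s :=
      hd.derivWithin (uniqueDiffOn_Ici s s self_mem_Ici)
    rw [tangent, rightTangent, h]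
    by_cases h0 : deriv C.path s = 0
    · simp [h0]
    · rw [smul_smul, mul_inv_cancel₀ (norm_ne_zero_iff.2 h0), one_smul]
  · rw [deriv_zero_of_not_differentiableAt hd, norm_zero, zero_smul]

theorem inner_ne_one {x y : E3} (hx : ‖x‖ = 1) (hy : ‖y‖ = 1) (hxy : y ≠ x) : inner ℝ x y ≠ 1 :=
  fun h => hxy ((inner_eq_one_iff_of_norm_eq_one hx hy).1 h).symm

theorem doubleLayerIntegrand_mul (μ : Sphere2 → ℝ) (x : Sphere2) {s : ℝ} (hs : C.pt s ≠ x) :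
    C.doubleLayerIntegrand C.tangent μ x s * ‖deriv C.path s‖ = μ (C.pt s) * C.kernel x s := by
  have hx : ‖(x : E3)‖ = 1 := by simp
  have hne : C.path s ≠ x := fun h => hs (Subtype.ext h)
  rw [doubleLayerIntegrand, mul_assoc, mul_comm (inner ℝ _ _), ← real_inner_smul_right,
    C.norm_deriv_smul_tangent, inner_surfaceCurl_fundamentalSolution (C.norm_path s)
      (inner_ne_one hx (C.norm_path s) hne), kernel]

/-- The numerator is a triple product with a repeated vector, so the kernel at its singular point is
harmless: it takes the value zero. -/
theorem kernel_eq_zero_of_path_eq {x : E3} {s : ℝ} (h : C.path s = x) : C.kernel x s = 0 := by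
  rw [kernel, h, inner_cross_self, zero_div, mul_zero]

theorem periodic_kernel (x : E3) : Function.Periodic (C.kernel x) (C.N : ℝ) := fun s => by
  simp only [kernel, C.periodic_path s, C.periodic_deriv_path s]

theorem measurable_kernel (x : E3) : Measurable (C.kernel x) := by
  unfold kernel
  have h1 : Continuous fun s => cross x (C.path s) :=
    continuous_cross.comp (continuous_const.prodMk C.continuous_path)
  have h2 : Continuous fun s => 1 - inner ℝ x (C.path s) :=
    continuous_const.sub (continuous_const.inner C.continuous_path)
  exact ((h1.measurable.inner (measurable_deriv C.path)).div h2.measurable).const_mul _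

theorem abs_kernel_le {x y y' : E3} {c M : ℝ} (hx : ‖x‖ = 1) (hy : ‖y‖ = 1) (hy' : ‖y'‖ ≤ M)
    (hc : 0 < c) (hxy : c ≤ 1 - inner ℝ x y) :
    |1 / (4 * Real.pi) * (inner ℝ (cross x y) y' / (1 - inner ℝ x y))| ≤ M / c := by
  have hM : 0 ≤ M := (norm_nonneg _).trans hy'
  have h1 : |inner ℝ (cross x y) y'| ≤ M := by
    have := abs_inner_cross_le x y y'
    rw [hx, hy] at this
    linarith
  have h4 : (1 : ℝ) / (4 * Real.pi) ≤ 1 := by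
    rw [div_le_one (by positivity)]; linarith [Real.pi_gt_three]
  rw [abs_mul, abs_of_nonneg (by positivity : (0 : ℝ) ≤ 1 / (4 * Real.pi)), abs_div,
    abs_of_pos (hc.trans_le hxy)]
  calc 1 / (4 * Real.pi) * (|inner ℝ (cross x y) y'| / (1 - inner ℝ x y))
      ≤ 1 * (M / c) := by
        have := hc.trans_le hxy
        gcongr
    _ = M / c := one_mul _

/-- Pointwise bound of the kernel at `τ` in terms of a point `σ` of the same arc. -/
theorem abs_kernel_le_of_nearest {x : E3} (hx : ‖x‖ = 1) {τ σ M M' l : ℝ} (hM : 0 ≤ M)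
    (hM' : ‖deriv C.path τ‖ ≤ M') (hl : 0 < l)
    (htaylor : ‖C.path σ - C.path τ - (σ - τ) • deriv C.path τ‖ ≤ M * (σ - τ) ^ 2)
    (hnear : ‖x - C.path σ‖ ≤ ‖x - C.path τ‖) (hlip : l * |σ - τ| ≤ ‖x - C.path τ‖) :
    |C.kernel x τ| ≤ M' * (2 * (‖x - C.path σ‖ /
      (‖x - C.path σ‖ ^ 2 + l ^ 2 * (τ - σ) ^ 2)) + M / l ^ 2) := by
  set d := ‖x - C.path σ‖ with hd
  set R := ‖x - C.path τ‖ with hR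
  have hd0 : 0 ≤ d := norm_nonneg _
  have hM'0 : 0 ≤ M' := (norm_nonneg _).trans hM'
  rcases (norm_nonneg (x - C.path τ)).eq_or_lt with h0 | hpos
  · have : C.path τ = x := (sub_eq_zero.1 (norm_eq_zero.1 h0.symm)).symm
    rw [C.kernel_eq_zero_of_path_eq this, abs_zero]
    positivity
  rw [← hR] at hpos
  have hR2 : R ^ 2 = 2 * (1 - inner ℝ x (C.path τ)) := norm_sub_sq_of_unit hx (C.norm_path τ)
  have hdet : |inner ℝ (cross x (C.path τ)) (deriv C.path τ)| ≤ M' * (d + M * (σ - τ) ^ 2) := by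
    -- Replace `x` by (x - path σ) + path σ. In the second part multiples of `path τ` and of the
    -- derivative drop out of the triple product, so only the Taylor remainder is left.
    have e : inner ℝ (cross x (C.path τ)) (deriv C.path τ) =
        inner ℝ (cross (x - C.path σ) (C.path τ)) (deriv C.path τ) +
        inner ℝ (cross (C.path σ - C.path τ - (σ - τ) • deriv C.path τ) (C.path τ))
          (deriv C.path τ) := by
      simp only [inner_cross_sub_left, inner_cross_smul_left, inner_cross_self]
      rw [inner_cross_left_self]; ring
    have h1 := abs_inner_cross_le (x - C.path σ) (C.path τ) (deriv C.path τ)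
    have h2 := abs_inner_cross_le (C.path σ - C.path τ - (σ - τ) • deriv C.path τ) (C.path τ)
      (deriv C.path τ)
    rw [C.norm_path, mul_one] at h1 h2
    rw [e]
    refine (abs_add_le _ _).trans ?_
    have h3 : d * ‖deriv C.path τ‖ ≤ d * M' := by gcongr
    have h4 : ‖C.path σ - C.path τ - (σ - τ) • deriv C.path τ‖ * ‖deriv C.path τ‖ ≤
        M * (σ - τ) ^ 2 * M' := by gcongr
    calc _ ≤ d * M' + M * (σ - τ) ^ 2 * M' := by linarith
      _ = _ := by ring
  have hlsq : l ^ 2 * (σ - τ) ^ 2 ≤ R ^ 2 := by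
    have := pow_le_pow_left₀ (by positivity) hlip 2
    rwa [mul_pow, sq_abs] at this
  have hdsq : d ^ 2 ≤ R ^ 2 := pow_le_pow_left₀ hd0 hnear 2
  -- The factor 2 comes from adding the two lower bounds d² and l² (τ - σ)² for R².
  have hbound1 : d / R ^ 2 ≤ 2 * (d / (d ^ 2 + l ^ 2 * (τ - σ) ^ 2)) := by
    rcases hd0.eq_or_lt with h | h
    · rw [← h]; simp
    · have hp : 0 < d ^ 2 + l ^ 2 * (τ - σ) ^ 2 := by positivity
      rw [mul_div_assoc', div_le_div_iff₀ (by positivity) hp]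
      have : (τ - σ) ^ 2 = (σ - τ) ^ 2 := by ring
      rw [this]
      nlinarith
  have hbound2 : M * (σ - τ) ^ 2 / R ^ 2 ≤ M / l ^ 2 := by
    rw [div_le_div_iff₀ (by positivity) (by positivity)]
    nlinarith
  have h4 : (1 : ℝ) / (2 * Real.pi) ≤ 1 := by
    rw [div_le_one (by positivity)]; linarith [Real.pi_gt_three]
  have hk : C.kernel x τ =
      1 / (2 * Real.pi) * (inner ℝ (cross x (C.path τ)) (deriv C.path τ) / R ^ 2) := by
    rw [kernel, hR2]
    have : 1 - inner ℝ x (C.path τ) ≠ 0 := by nlinarith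
    field_simp
    ring
  rw [hk, abs_mul, abs_of_nonneg (by positivity : (0 : ℝ) ≤ 1 / (2 * Real.pi)), abs_div,
    abs_of_pos (by positivity : 0 < R ^ 2)]
  calc 1 / (2 * Real.pi) * (|inner ℝ (cross x (C.path τ)) (deriv C.path τ)| / R ^ 2)
      ≤ 1 * (M' * (d + M * (σ - τ) ^ 2) / R ^ 2) := by gcongr
    _ = M' * (d / R ^ 2 + M * (σ - τ) ^ 2 / R ^ 2) := by ring
    _ ≤ _ := by gcongr

/-- Integrable majorant of the kernel on an arc, with a bound that does not depend on `x`. -/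
theorem exists_arc_majorant {A B M M' l : ℝ} (hAB : A ≤ B) (hM : 0 ≤ M) (hM'0 : 0 ≤ M')
    (hM' : ∀ τ, ‖deriv C.path τ‖ ≤ M') (hl : 0 < l)
    (htaylor : ∀ τ ∈ Ioo A B, ∀ σ ∈ Icc A B,
      ‖C.path σ - C.path τ - (σ - τ) • deriv C.path τ‖ ≤ M * (σ - τ) ^ 2)
    (hlip : ∀ τ ∈ Icc A B, ∀ σ ∈ Icc A B, l * |σ - τ| ≤ ‖C.path σ - C.path τ‖)
    {x : E3} (hx : ‖x‖ = 1) :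
    ∃ g : ℝ → ℝ, (∀ a b, IntervalIntegrable g volume a b) ∧ (∀ τ, 0 ≤ g τ) ∧
      (∀ τ ∈ Ioo A B, |C.kernel x τ| ≤ g τ) ∧
      ∀ a b, a ≤ b → ∫ τ in a..b, g τ ≤
        M' * (2 * (Real.pi / (l / 2)) + M / (l / 2) ^ 2 * (b - a)) := by
  -- `C.path σ` is a point of the arc nearest to `x`. By the triangle inequality ‖path σ - path τ‖ ≤
  -- 2 ‖x - path τ‖, which is why `l / 2` replaces `l`.
  obtain ⟨σ, hσ, hmin⟩ := isCompact_Icc.exists_isMinOn (nonempty_Icc.2 hAB)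
    (continuous_const.sub C.continuous_path : Continuous fun τ => x - C.path τ).norm.continuousOn
  have hmin' : ∀ τ ∈ Icc A B, ‖x - C.path σ‖ ≤ ‖x - C.path τ‖ := fun τ hτ => hmin hτ
  refine ⟨fun τ => M' * (2 * (‖x - C.path σ‖ /
      (‖x - C.path σ‖ ^ 2 + (l / 2) ^ 2 * (τ - σ) ^ 2)) + M / (l / 2) ^ 2), ?_, ?_, ?_, ?_⟩
  · intro a b
    exact (((integral_poisson_le (norm_nonneg _) (half_pos hl) σ a b).1.const_mul 2).add
      intervalIntegrable_const).const_mul M'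
  · intro τ; positivity
  · intro τ hτ
    refine C.abs_kernel_le_of_nearest hx hM (hM' τ) (half_pos hl) (htaylor τ hτ σ hσ)
      (hmin' τ (Ioo_subset_Icc_self hτ)) ?_
    have h1 := hlip τ (Ioo_subset_Icc_self hτ) σ hσ
    have h2 : ‖C.path σ - C.path τ‖ ≤ ‖x - C.path τ‖ + ‖x - C.path σ‖ := by
      have : C.path σ - C.path τ = (x - C.path τ) - (x - C.path σ) := by abel
      rw [this]; exact norm_sub_le _ _
    have h3 := hmin' τ (Ioo_subset_Icc_self hτ)
    linarith
  · intro a b hab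
    have hi := integral_poisson_le (norm_nonneg (x - C.path σ)) (half_pos hl) σ a b
    rw [intervalIntegral.integral_const_mul,
      intervalIntegral.integral_add (hi.1.const_mul 2) intervalIntegrable_const,
      intervalIntegral.integral_const_mul, intervalIntegral.integral_const, smul_eq_mul]
    have := hi.2
    rw [mul_comm (b - a)]
    gcongr

/-- On each side of `s` the component of `deriv C.path` along `a` stays above half the smaller of
the two one-sided values, and the mean value theorem applies. This makes each adjacent arc
bi-Lipschitz near `s`. -/
theorem eventually_mul_sub_le (a : E3) (s : ℝ) (hR : 0 < inner ℝ (C.rightDeriv s) a)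
    (hL : 0 < inner ℝ (C.leftDeriv s) a) : ∃ l > 0, ∃ η₀ > 0,
    (∀ τ ∈ Icc s (s + η₀), ∀ σ ∈ Icc s (s + η₀), τ ≤ σ →
      l * (σ - τ) ≤ inner ℝ (C.path σ) a - inner ℝ (C.path τ) a) ∧
    (∀ τ ∈ Icc (s - η₀) s, ∀ σ ∈ Icc (s - η₀) s, τ ≤ σ →
      l * (σ - τ) ≤ inner ℝ (C.path σ) a - inner ℝ (C.path τ) a) := by
  set l := min (inner ℝ (C.rightDeriv s) a) (inner ℝ (C.leftDeriv s) a) / 2 with hl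
  have hl0 : 0 < l := by have := lt_min hR hL; positivity
  have hlR : l < inner ℝ (C.rightDeriv s) a := by
    have := min_le_left (inner ℝ (C.rightDeriv s) a) (inner ℝ (C.leftDeriv s) a)
    linarith
  have hlL : l < inner ℝ (C.leftDeriv s) a := by
    have := min_le_right (inner ℝ (C.rightDeriv s) a) (inner ℝ (C.leftDeriv s) a)
    linarith
  obtain ⟨_, _, η₁, hη₁, hd₁, _⟩ := C.eventually_taylor_right s
  obtain ⟨_, _, η₂, hη₂, hd₂, _⟩ := C.eventually_taylor_left s
  have hr : ∀ᶠ τ in 𝓝[>] s, l < inner ℝ (deriv C.path τ) a :=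
    ((C.tendsto_deriv_right s).inner tendsto_const_nhds).eventually (lt_mem_nhds hlR)
  have hle : ∀ᶠ τ in 𝓝[<] s, l < inner ℝ (deriv C.path τ) a :=
    ((C.tendsto_deriv_left s).inner tendsto_const_nhds).eventually (lt_mem_nhds hlL)
  obtain ⟨u, hu, hus⟩ := mem_nhdsGT_iff_exists_Ioo_subset.1 hr
  obtain ⟨v, hv, hvs⟩ := mem_nhdsLT_iff_exists_Ioo_subset.1 hle
  rw [mem_Ioi] at hu
  rw [mem_Iio] at hv
  have hcont : Continuous fun τ => inner ℝ (C.path τ) a :=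
    C.continuous_path.inner continuous_const
  have hder (τ : ℝ) (h : DifferentiableAt ℝ C.path τ) :
      HasDerivAt (fun τ => inner ℝ (C.path τ) a) (inner ℝ (deriv C.path τ) a) τ := by
    simpa using h.hasDerivAt.inner ℝ (hasDerivAt_const τ a)
  refine ⟨l, hl0, min (min η₁ (u - s)) (min η₂ (s - v)),
    lt_min (lt_min hη₁ (by linarith)) (lt_min hη₂ (by linarith)), ?_, ?_⟩
  · set η := min (min η₁ (u - s)) (min η₂ (s - v))
    have e1 : η ≤ η₁ := (min_le_left _ _).trans (min_le_left _ _)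
    have e2 : η ≤ u - s := (min_le_left _ _).trans (min_le_right _ _)
    refine (convex_Icc s (s + η)).mul_sub_le_image_sub_of_le_deriv hcont.continuousOn ?_ ?_
    · rw [interior_Icc]
      exact fun τ hτ =>
        (hder τ (hd₁ τ ⟨hτ.1, by linarith [hτ.2]⟩)).differentiableAt.differentiableWithinAt
    · rw [interior_Icc]
      intro τ hτ
      rw [(hder τ (hd₁ τ ⟨hτ.1, by linarith [hτ.2]⟩)).deriv]
      exact (hus ⟨hτ.1, by linarith [hτ.2]⟩ : l < _).le
  · set η := min (min η₁ (u - s)) (min η₂ (s - v))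
    have e1 : η ≤ η₂ := (min_le_right _ _).trans (min_le_left _ _)
    have e2 : η ≤ s - v := (min_le_right _ _).trans (min_le_right _ _)
    refine (convex_Icc (s - η) s).mul_sub_le_image_sub_of_le_deriv hcont.continuousOn ?_ ?_
    · rw [interior_Icc]
      exact fun τ hτ =>
        (hder τ (hd₂ τ ⟨by linarith [hτ.1], hτ.2⟩)).differentiableAt.differentiableWithinAt
    · rw [interior_Icc]
      intro τ hτ
      rw [(hder τ (hd₂ τ ⟨by linarith [hτ.1], hτ.2⟩)).deriv]
      exact (hvs ⟨by linarith [hτ.1], hτ.2⟩ : l < _).le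

/-- Near a point of the curve the kernel has integrable majorants whose integrals are bounded
uniformly in `x`. -/
theorem exists_kernel_majorant (s : ℝ) : ∃ η₀ > 0, ∃ M : ℝ, 0 ≤ M ∧ ∀ x : E3, ‖x‖ = 1 →
    ∃ g : ℝ → ℝ, (∀ a b, IntervalIntegrable g volume a b) ∧
      (∀ τ ∈ Ioo (s - η₀) (s + η₀), τ ≠ s → |C.kernel x τ| ≤ g τ) ∧
      ∀ η, 0 < η → η ≤ η₀ → ∫ τ in (s - η)..(s + η), g τ ≤ M := by
  obtain ⟨a, ha, -, haR, haL⟩ := C.exists_transversal s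
  obtain ⟨l, hl, η₁, hη₁, hlR, hlL⟩ := C.eventually_mul_sub_le a s haR haL
  obtain ⟨M₂, hM₂, η₂, hη₂, -, ht₂⟩ := C.eventually_taylor_right s
  obtain ⟨M₃, hM₃, η₃, hη₃, -, ht₃⟩ := C.eventually_taylor_left s
  obtain ⟨M', hM'0, hM'⟩ := C.exists_norm_deriv_le
  have hbil {A B : ℝ} (h : ∀ τ ∈ Icc A B, ∀ σ ∈ Icc A B, τ ≤ σ →
      l * (σ - τ) ≤ inner ℝ (C.path σ) a - inner ℝ (C.path τ) a) :
      ∀ τ ∈ Icc A B, ∀ σ ∈ Icc A B, l * |σ - τ| ≤ ‖C.path σ - C.path τ‖ := by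
    have hin (σ τ : ℝ) : inner ℝ (C.path σ) a - inner ℝ (C.path τ) a ≤
        ‖C.path σ - C.path τ‖ := by
      rw [← inner_sub_left]
      have := real_inner_le_norm (C.path σ - C.path τ) a
      rwa [ha, mul_one] at this
    intro τ hτ σ hσ
    rcases le_total τ σ with hle | hle
    · rw [abs_of_nonneg (sub_nonneg.2 hle)]
      exact (h τ hτ σ hσ hle).trans (hin σ τ)
    · rw [abs_sub_comm, abs_of_nonneg (sub_nonneg.2 hle), norm_sub_rev]
      exact (h σ hσ τ hτ hle).trans (hin τ σ)
  set η₀ := min η₁ (min η₂ η₃) with hη₀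
  have hpos : 0 < η₀ := lt_min hη₁ (lt_min hη₂ hη₃)
  have e1 : η₀ ≤ η₁ := min_le_left _ _
  have e2 : η₀ ≤ η₂ := (min_le_right _ _).trans (min_le_left _ _)
  have e3 : η₀ ≤ η₃ := (min_le_right _ _).trans (min_le_right _ _)
  refine ⟨η₀, hpos, M' * (2 * (Real.pi / (l / 2)) + M₂ / (l / 2) ^ 2 * (2 * η₀)) +
    M' * (2 * (Real.pi / (l / 2)) + M₃ / (l / 2) ^ 2 * (2 * η₀)), by positivity, fun x hx => ?_⟩
  have sR : Icc s (s + η₀) ⊆ Icc s (s + η₁) := Icc_subset_Icc_right (by linarith)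
  have sR' : Icc s (s + η₀) ⊆ Icc s (s + η₂) := Icc_subset_Icc_right (by linarith)
  have sRo : Ioo s (s + η₀) ⊆ Ioo s (s + η₂) := Ioo_subset_Ioo_right (by linarith)
  have sL : Icc (s - η₀) s ⊆ Icc (s - η₁) s := Icc_subset_Icc_left (by linarith)
  have sL' : Icc (s - η₀) s ⊆ Icc (s - η₃) s := Icc_subset_Icc_left (by linarith)
  have sLo : Ioo (s - η₀) s ⊆ Ioo (s - η₃) s := Ioo_subset_Ioo_left (by linarith)
  obtain ⟨g, hg1, hg2, hg3, hg4⟩ := C.exists_arc_majorant (A := s) (B := s + η₀) (by linarith)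
    hM₂ hM'0 hM' hl (fun τ hτ σ hσ => ht₂ τ (sRo hτ) σ (sR' hσ))
    (hbil fun τ hτ σ hσ => hlR τ (sR hτ) σ (sR hσ)) hx
  obtain ⟨k, hk1, hk2, hk3, hk4⟩ := C.exists_arc_majorant (A := s - η₀) (B := s) (by linarith)
    hM₃ hM'0 hM' hl (fun τ hτ σ hσ => ht₃ τ (sLo hτ) σ (sL' hσ))
    (hbil fun τ hτ σ hσ => hlL τ (sL hτ) σ (sL hσ)) hx
  -- The majorants for the outgoing and the incoming arc are nonnegative, so their sum serves on
  -- both sides; neither covers the parameter `s` itself.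
  refine ⟨fun τ => g τ + k τ, fun a b => (hg1 a b).add (hk1 a b), ?_, ?_⟩
  · intro τ hτ hne
    rcases lt_or_gt_of_ne hne with h | h
    · exact (hk3 τ ⟨hτ.1, h⟩).trans (le_add_of_nonneg_left (hg2 τ))
    · exact (hg3 τ ⟨h, hτ.2⟩).trans (le_add_of_nonneg_right (hk2 τ))
  · intro η hη hle
    rw [intervalIntegral.integral_add (hg1 _ _) (hk1 _ _)]
    have h1 := hg4 (s - η) (s + η) (by linarith)
    have h2 := hk4 (s - η) (s + η) (by linarith)
    have h3 : s + η - (s - η) ≤ 2 * η₀ := by linarith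
    refine add_le_add (h1.trans ?_) (h2.trans ?_) <;> gcongr

end SphereCurve

namespace SphereCurve

variable (C : SphereCurve)

/-! ### Integrability, the principal value, and reduction to the local jump -/

theorem N_pos_real : (0 : ℝ) < C.N := by exact_mod_cast C.N_pos

/-- Reduce both parameters to [0, N). If the points agreed, injectivity would make the parameters
differ by an integer multiple of N, and that integer would lie strictly between 0 and 1. -/
theorem path_ne_of_lt {s τ : ℝ} (h1 : s < τ) (h2 : τ < s + C.N) : C.path τ ≠ C.path s := by
  intro h
  have hpt : C.pt τ = C.pt s := Subtype.ext h
  have hN := C.N_pos_real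
  have e (σ : ℝ) : C.pt (toIcoMod hN 0 σ) = C.pt σ :=
    C.periodic.sub_zsmul_eq (x := σ) (toIcoDiv hN 0 σ)
  have hm (σ : ℝ) : toIcoMod hN 0 σ ∈ Ico 0 (C.N : ℝ) := by
    simpa using toIcoMod_mem_Ico hN 0 σ
  have heq : toIcoMod hN 0 τ = toIcoMod hN 0 s :=
    C.injOn (hm τ) (hm s) (by rw [e, e, hpt])
  simp only [toIcoMod, zsmul_eq_mul] at heq
  have hk : τ - s = ((toIcoDiv hN 0 τ - toIcoDiv hN 0 s : ℤ) : ℝ) * C.N := by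
    push_cast; linarith
  set k := toIcoDiv hN 0 τ - toIcoDiv hN 0 s
  have hk0 : (0 : ℝ) < k := by
    by_contra hc
    have : (k : ℝ) * C.N ≤ 0 := mul_nonpos_of_nonpos_of_nonneg (not_lt.1 hc) hN.le
    linarith
  have hk1 : (k : ℝ) < 1 := by
    by_contra hc
    have : 1 * (C.N : ℝ) ≤ k * C.N := mul_le_mul_of_nonneg_right (not_lt.1 hc) hN.le
    linarith
  have hk0' : 0 < k := by exact_mod_cast hk0
  have hk1' : k < 1 := by exact_mod_cast hk1
  omega

/-- On a compact parameter interval that avoids `x₀`, the kernel is bounded near `x₀`. -/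
theorem exists_kernel_bound_of_ne {x₀ : E3} (hx₀ : ‖x₀‖ = 1) {A B : ℝ} (hAB : A ≤ B)
    (hne : ∀ τ ∈ Icc A B, C.path τ ≠ x₀) : ∃ δ > 0, ∃ M : ℝ, ∀ x : E3, ‖x‖ = 1 →
      ‖x - x₀‖ < δ → ∀ τ ∈ Icc A B, |C.kernel x τ| ≤ M := by
  have hcont : ContinuousOn (fun τ => 1 - inner ℝ x₀ (C.path τ)) (Icc A B) :=
    (continuous_const.sub (continuous_const.inner C.continuous_path)).continuousOn
  obtain ⟨σ, hσ, hmin⟩ := isCompact_Icc.exists_isMinOn (nonempty_Icc.2 hAB) hcont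
  have hpos : 0 < 1 - inner ℝ x₀ (C.path σ) := by
    have h1 := inner_ne_one hx₀ (C.norm_path σ) (hne σ hσ)
    have h2 := real_inner_le_norm x₀ (C.path σ)
    rw [hx₀, C.norm_path, one_mul] at h2
    exact sub_pos.2 (lt_of_le_of_ne h2 h1)
  obtain ⟨M', -, hM'⟩ := C.exists_norm_deriv_le
  set c := 1 - inner ℝ x₀ (C.path σ) with hc
  -- Moving `x₀` by less than `c / 2` changes the inner product by less than `c / 2`, so at least
  -- half of the minimal gap `c` survives.
  refine ⟨c / 2, half_pos hpos, M' / (c / 2), fun x hx hxx τ hτ => ?_⟩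
  refine abs_kernel_le hx (C.norm_path τ) (hM' τ) (half_pos hpos) ?_
  have h1 : c ≤ 1 - inner ℝ x₀ (C.path τ) := hmin hτ
  have h2 := real_inner_le_norm (x - x₀) (C.path τ)
  rw [C.norm_path, mul_one, inner_sub_left] at h2
  linarith

theorem intervalIntegrable_kernel_of_ne {x : E3} (hx : ‖x‖ = 1) {A B : ℝ} (hAB : A ≤ B)
    (hne : ∀ τ ∈ Icc A B, C.path τ ≠ x) : IntervalIntegrable (C.kernel x) volume A B := by
  obtain ⟨δ, hδ, M, hM⟩ := C.exists_kernel_bound_of_ne hx hAB hne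
  refine (intervalIntegrable_const (c := M)).mono_fun'
    (C.measurable_kernel x).aestronglyMeasurable ?_
  refine (ae_restrict_iff' measurableSet_uIoc).2 (Eventually.of_forall fun τ hτ => ?_)
  rw [uIoc_of_le hAB] at hτ
  exact hM x hx (by simpa using hδ) τ (Ioc_subset_Icc_self hτ)

/-- Near a point of the curve, integrals against the kernel are bounded uniformly in `x`. -/
theorem exists_integral_kernel_bound (s : ℝ) : ∃ η₀ > 0, ∃ M : ℝ, 0 ≤ M ∧
    ∀ η, 0 < η → η ≤ η₀ → ∀ x : E3, ‖x‖ = 1 →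
      IntervalIntegrable (C.kernel x) volume (s - η) (s + η) ∧
      ∀ (h : ℝ → ℝ) (ε : ℝ), 0 ≤ ε → (∀ τ ∈ Icc (s - η) (s + η), |h τ| ≤ ε) →
        |∫ τ in (s - η)..(s + η), h τ * C.kernel x τ| ≤ ε * M := by
  obtain ⟨η₀, hη₀, M, hM, H⟩ := C.exists_kernel_majorant s
  -- Halving puts the closed interval inside the open one on which the majorant is valid.
  refine ⟨η₀ / 2, half_pos hη₀, M, hM, fun η hη hle x hx => ?_⟩
  obtain ⟨g, hg1, hg2, hg3⟩ := H x hx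
  have hlt : s - η ≤ s + η := by linarith
  have hae : ∀ᵐ τ : ℝ, τ ∈ uIoc (s - η) (s + η) → |C.kernel x τ| ≤ g τ := by
    have : ∀ᵐ τ : ℝ, τ ≠ s := by simp [ae_iff, measure_singleton]
    filter_upwards [this] with τ hτ hmem
    rw [uIoc_of_le hlt] at hmem
    exact hg2 τ ⟨by linarith [hmem.1], by linarith [hmem.2]⟩ hτ
  refine ⟨(hg1 _ _).mono_fun' (C.measurable_kernel x).aestronglyMeasurable
    ((ae_restrict_iff' measurableSet_uIoc).2 hae), fun h ε hε hh => ?_⟩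
  have hb : ∀ᵐ τ : ℝ, τ ∈ Ioc (s - η) (s + η) → ‖h τ * C.kernel x τ‖ ≤ ε * g τ := by
    filter_upwards [hae] with τ hτ hmem
    rw [Real.norm_eq_abs, abs_mul]
    refine mul_le_mul (hh τ (Ioc_subset_Icc_self hmem)) (hτ ?_) (abs_nonneg _) hε
    rwa [uIoc_of_le hlt]
  have := intervalIntegral.norm_integral_le_of_norm_le hlt hb ((hg1 _ _).const_mul ε)
  rw [intervalIntegral.integral_const_mul] at this
  exact this.trans (mul_le_mul_of_nonneg_left (hg3 η hη (by linarith)) hε)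

theorem path_ne_of_mem_far {s η τ : ℝ} (hη : 0 < η) (hτ : τ ∈ Icc (s + η) (s - η + C.N)) :
    C.path τ ≠ C.path s :=
  C.path_ne_of_lt (by linarith [hτ.1]) (by linarith [hτ.2])

/-- Near `s` the uniform majorant applies with `x` on the curve; the rest of one period avoids the
singular point; periodicity does the rest. -/
theorem intervalIntegrable_kernel_self (s A B : ℝ) :
    IntervalIntegrable (C.kernel (C.path s)) volume A B := by
  obtain ⟨η₀, hη₀, M, -, H⟩ := C.exists_integral_kernel_bound s
  have hN := C.N_pos_real
  set η := min η₀ (C.N / 2) with hη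
  have hpos : 0 < η := lt_min hη₀ (half_pos hN)
  have hle : s + η ≤ s - η + C.N := by
    have : η ≤ C.N / 2 := min_le_right _ _
    linarith
  have h1 := (H η hpos (min_le_left _ _) _ (C.norm_path s)).1
  have h2 := C.intervalIntegrable_kernel_of_ne (C.norm_path s) hle
    fun τ hτ => C.path_ne_of_mem_far hpos hτ
  exact (C.periodic_kernel _).intervalIntegrable hN.ne' (h1.trans h2) A B

variable {C} {μ : Sphere2 → ℝ}

theorem continuous_density (hμ : ContinuousOn μ C.carrier) : Continuous fun τ => μ (C.pt τ) :=
  hμ.comp_continuous C.continuous_pt fun τ => mem_range_self τ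

theorem periodic_density : Function.Periodic (fun τ => μ (C.pt τ)) (C.N : ℝ) := fun τ => by
  simp only [C.periodic τ]

/-- Off the curve the singularity is never met, and periodicity allows the period to start anywhere,
later just before the point of interest. -/
theorem doubleLayer_eq {x : Sphere2} (hx : x ∉ C.carrier) (a : ℝ) :
    C.doubleLayer C.tangent μ x = ∫ τ in a..(a + C.N), μ (C.pt τ) * C.kernel x τ := by
  rw [doubleLayer, lineIntegral, inter_univ]
  have hper : Function.Periodic (fun τ => μ (C.pt τ) * C.kernel x τ) (C.N : ℝ) :=
    (periodic_density (μ := μ)).mul (C.periodic_kernel x)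
  rw [hper.intervalIntegral_add_eq a 0, zero_add, intervalIntegral.integral_of_le C.N_pos_real.le]
  refine setIntegral_congr_fun measurableSet_Ioc fun τ _ => ?_
  exact C.doubleLayerIntegrand_mul μ x fun h => hx ⟨τ, h⟩

theorem doubleLayer_neg (t : ℝ → E3) (x : Sphere2) :
    C.doubleLayer (-t) μ x = -C.doubleLayer t μ x := by
  simp only [doubleLayer, lineIntegral, doubleLayerIntegrand, Pi.neg_apply, inner_neg_right,
    mul_neg, neg_mul, integral_neg]

/-- The principal value is an absolutely convergent integral. -/
theorem tendsto_truncK (hμ : ContinuousOn μ C.carrier) (s : ℝ) :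
    Tendsto (C.truncK C.tangent μ (C.pt s)) (𝓝[>] 0)
      (𝓝 (∫ τ in (0 : ℝ)..C.N, μ (C.pt τ) * C.kernel (C.path s) τ)) := by
  set f : ℝ → ℝ := fun τ => μ (C.pt τ) * C.kernel (C.path s) τ with hf
  set A : ℝ → Set ℝ := fun ε => {τ | ε ≤ ‖C.path τ - C.path s‖} with hA
  have hAm (ε : ℝ) : MeasurableSet (A ε) :=
    (isClosed_le continuous_const (C.continuous_path.sub continuous_const).norm).measurableSet
  have hki : IntervalIntegrable f volume 0 C.N :=
    (C.intervalIntegrable_kernel_self s 0 C.N).continuousOn_mul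
      (continuous_density hμ).continuousOn
  have hki' : IntegrableOn f (Ioc 0 (C.N : ℝ)) :=
    (intervalIntegrable_iff_integrableOn_Ioc_of_le C.N_pos_real.le).1 hki
  have heq : ∀ ε > 0, C.truncK C.tangent μ (C.pt s) ε =
      ∫ τ in Ioc 0 (C.N : ℝ), (A ε).indicator f τ := by
    intro ε hε
    rw [truncK, lineIntegral, setIntegral_indicator (hAm ε)]
    refine setIntegral_congr_fun (measurableSet_Ioc.inter (hAm ε)) fun τ hτ => ?_
    refine C.doubleLayerIntegrand_mul μ (C.pt s) fun h => ?_
    have h2 : ε ≤ ‖C.path τ - C.path s‖ := hτ.2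
    have h3 : C.path τ = C.path s := congrArg Subtype.val h
    rw [h3, sub_self, norm_zero] at h2
    linarith
  have hlim : Tendsto (fun ε => ∫ τ in Ioc 0 (C.N : ℝ), (A ε).indicator f τ) (𝓝[>] 0)
      (𝓝 (∫ τ in Ioc 0 (C.N : ℝ), f τ)) := by
    -- The untruncated integrand dominates. Pointwise, the truncation is eventually inactive away
    -- from the centre, and at the centre the kernel vanishes anyway.
    refine tendsto_integral_filter_of_dominated_convergence (fun τ => ‖f τ‖)
      (Eventually.of_forall fun ε => hki'.aestronglyMeasurable.indicator (hAm ε))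
      (Eventually.of_forall fun ε => Eventually.of_forall fun τ =>
        norm_indicator_le_norm_self f τ) hki'.norm (Eventually.of_forall fun τ => ?_)
    by_cases h : C.path τ = C.path s
    · have h0 : f τ = 0 := by simp only [hf, C.kernel_eq_zero_of_path_eq h, mul_zero]
      have : ∀ ε, (A ε).indicator f τ = f τ := fun ε => by
        by_cases hm : τ ∈ A ε
        · exact indicator_of_mem hm f
        · rw [indicator_of_notMem hm, h0]
      simp only [this]
      exact tendsto_const_nhds
    · have hpos : 0 < ‖C.path τ - C.path s‖ := norm_pos_iff.2 (sub_ne_zero.2 h)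
      refine tendsto_const_nhds.congr' ?_
      filter_upwards [nhdsWithin_le_nhds (gt_mem_nhds hpos)] with ε hε
      exact (indicator_of_mem (show τ ∈ A ε from le_of_lt hε) f).symm
  rw [intervalIntegral.integral_of_le C.N_pos_real.le]
  refine hlim.congr' ?_
  filter_upwards [self_mem_nhdsWithin] with ε hε
  exact (heq ε hε).symm

/-- Away from `x₀` the kernel is continuous in `x` and bounded uniformly for `x` near `x₀`, so the
far part of the potential does not jump. -/
theorem tendsto_integral_kernel_far {m : ℝ → ℝ} (hm : Continuous m) (x₀ : Sphere2) {A B : ℝ}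
    (hAB : A ≤ B) (hne : ∀ τ ∈ Icc A B, C.path τ ≠ x₀) :
    Tendsto (fun x : Sphere2 => ∫ τ in A..B, m τ * C.kernel x τ) (𝓝 x₀)
      (𝓝 (∫ τ in A..B, m τ * C.kernel x₀ τ)) := by
  have hx₀ : ‖(x₀ : E3)‖ = 1 := by simp
  obtain ⟨δ, hδ, M, hM⟩ := C.exists_kernel_bound_of_ne hx₀ hAB hne
  refine intervalIntegral.tendsto_integral_filter_of_dominated_convergence
    (fun τ => |m τ| * M) ?_ ?_ ?_ ?_
  · exact Eventually.of_forall fun x =>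
      (hm.measurable.mul (C.measurable_kernel x)).aestronglyMeasurable
  · filter_upwards [Metric.ball_mem_nhds x₀ hδ] with x hx
    refine Eventually.of_forall fun τ hτ => ?_
    rw [uIoc_of_le hAB] at hτ
    rw [Real.norm_eq_abs, abs_mul]
    refine mul_le_mul_of_nonneg_left (hM x (by simp) ?_ τ (Ioc_subset_Icc_self hτ)) (abs_nonneg _)
    rwa [Metric.mem_ball, Subtype.dist_eq, dist_eq_norm] at hx
  · exact (hm.abs.mul continuous_const).intervalIntegrable _ _
  · refine Eventually.of_forall fun τ hτ => ?_
    rw [uIoc_of_le hAB] at hτ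
    have hne' : 1 - inner ℝ (x₀ : E3) (C.path τ) ≠ 0 :=
      sub_ne_zero.2 (inner_ne_one hx₀ (C.norm_path τ) (hne τ (Ioc_subset_Icc_self hτ))).symm
    have h1 : Continuous fun x : Sphere2 => inner ℝ (cross (x : E3) (C.path τ)) (deriv C.path τ) :=
      (continuous_cross.comp (continuous_subtype_val.prodMk continuous_const)).inner
        continuous_const
    have h2 : Continuous fun x : Sphere2 => 1 - inner ℝ (x : E3) (C.path τ) :=
      continuous_const.sub (continuous_subtype_val.inner continuous_const)
    exact ((h1.continuousAt.tendsto.div h2.continuousAt.tendsto hne').const_mul _).const_mul _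

/-- If the integral of the kernel over a short piece of the curve around `C.pt s` jumps by `J`,
then the double layer potential jumps by `J` times the density. -/
theorem tendsto_doubleLayer (hμ : ContinuousOn μ C.carrier) (s : ℝ) {D : Set Sphere2} {J : ℝ}
    (hD : Disjoint D C.carrier)
    (hJ : ∃ η₁ > 0, ∀ η, 0 < η → η ≤ η₁ →
      Tendsto (fun x : Sphere2 => ∫ τ in (s - η)..(s + η),
        (C.kernel x τ - C.kernel (C.path s) τ)) (𝓝[D] (C.pt s)) (𝓝 J)) :
    Tendsto (C.doubleLayer C.tangent μ) (𝓝[D] (C.pt s))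
      (𝓝 ((∫ τ in (0 : ℝ)..C.N, μ (C.pt τ) * C.kernel (C.path s) τ) + J * μ (C.pt s))) := by
  obtain ⟨η₁, hη₁, hJ⟩ := hJ
  obtain ⟨η₀, hη₀, M, hM, H⟩ := C.exists_integral_kernel_bound s
  have hN := C.N_pos_real
  have hm := continuous_density hμ
  set m : ℝ → ℝ := fun τ => μ (C.pt τ) with hmdef
  have hm0 : μ (C.pt s) = m s := rfl
  rw [hm0]
  rw [Metric.tendsto_nhds]
  intro ε hε
  -- Two oscillation terms cost `e * M` each, the jump term `|m s| * e`, the far term `e`; the spare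
  -- `e` keeps the total strictly below `ε`.
  set e := ε / (2 * M + 2 + |m s|) with he
  have hden : 0 < 2 * M + 2 + |m s| := by positivity
  have hepos : 0 < e := div_pos hε hden
  obtain ⟨η₂, hη₂, hcont⟩ := Metric.continuousAt_iff.1 hm.continuousAt e hepos
  set η := min (min η₀ η₁) (min (η₂ / 2) (C.N / 2)) with hη
  have hpos : 0 < η := lt_min (lt_min hη₀ hη₁) (lt_min (half_pos hη₂) (half_pos hN))
  have e0 : η ≤ η₀ := (min_le_left _ _).trans (min_le_left _ _)
  have e1 : η ≤ η₁ := (min_le_left _ _).trans (min_le_right _ _)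
  have e2 : η ≤ η₂ / 2 := (min_le_right _ _).trans (min_le_left _ _)
  have e3 : η ≤ C.N / 2 := (min_le_right _ _).trans (min_le_right _ _)
  have hosc : ∀ τ ∈ Icc (s - η) (s + η), |m τ - m s| ≤ e := by
    intro τ hτ
    have : dist τ s < η₂ := by
      rw [Real.dist_eq, abs_lt]
      constructor <;> linarith [hτ.1, hτ.2]
    exact (hcont this).le
  have hfar : Tendsto (fun x : Sphere2 => ∫ τ in (s + η)..(s - η + C.N), m τ * C.kernel x τ)
      (𝓝[D] (C.pt s))
      (𝓝 (∫ τ in (s + η)..(s - η + C.N), m τ * C.kernel (C.path s) τ)) :=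
    (tendsto_integral_kernel_far hm (C.pt s) (by linarith)
      fun τ hτ => C.path_ne_of_mem_far hpos hτ).mono_left nhdsWithin_le_nhds
  -- Freeze the density at `m s` near `s`: the oscillation is uniformly small, the frozen part
  -- carries the jump, and the far part is continuous in `x`.
  have hsplit (x : E3) (hx : ‖x‖ = 1)
      (hi : IntervalIntegrable (C.kernel x) volume (s + η) (s - η + C.N)) :
      ∫ τ in (s - η)..(s - η + C.N), m τ * C.kernel x τ =
        (∫ τ in (s - η)..(s + η), (m τ - m s) * C.kernel x τ) +
        m s * (∫ τ in (s - η)..(s + η), C.kernel x τ) +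
        ∫ τ in (s + η)..(s - η + C.N), m τ * C.kernel x τ := by
    have hk := (H η hpos e0 x hx).1
    rw [← intervalIntegral.integral_add_adjacent_intervals
      (hk.continuousOn_mul hm.continuousOn) (hi.continuousOn_mul hm.continuousOn)]
    congr 1
    have hk' : IntervalIntegrable (fun τ => (m τ - m s) * C.kernel x τ) volume (s - η) (s + η) :=
      hk.continuousOn_mul (hm.sub continuous_const).continuousOn
    rw [← intervalIntegral.integral_const_mul,
      ← intervalIntegral.integral_add hk' (hk.const_mul _)]
    congr 1
    funext τ
    ring
  have hL : ∫ τ in (0 : ℝ)..C.N, m τ * C.kernel (C.path s) τ =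
      ∫ τ in (s - η)..(s - η + C.N), m τ * C.kernel (C.path s) τ := by
    have hper : Function.Periodic (fun τ => m τ * C.kernel (C.path s) τ) (C.N : ℝ) :=
      (periodic_density (μ := μ)).mul (C.periodic_kernel _)
    rw [hper.intervalIntegral_add_eq (s - η) 0, zero_add]
  rw [hL]
  filter_upwards [self_mem_nhdsWithin, Metric.tendsto_nhds.1 hfar e hepos,
    Metric.tendsto_nhds.1 (hJ η hpos e1) e hepos] with x hxD hx1 hx2
  have hxC : x ∉ C.carrier := fun h => disjoint_left.1 hD hxD h
  have hxn : ‖(x : E3)‖ = 1 := by simp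
  have hki : IntervalIntegrable (C.kernel x) volume (s + η) (s - η + C.N) :=
    C.intervalIntegrable_kernel_of_ne hxn (by linarith) fun τ _ h => hxC ⟨τ, Subtype.ext h⟩
  rw [doubleLayer_eq hxC (s - η), hsplit x hxn hki,
    hsplit _ (C.norm_path s) (C.intervalIntegrable_kernel_self s _ _), Real.dist_eq]
  have b1 := (H η hpos e0 x hxn).2 _ e hepos.le hosc
  have b2 := (H η hpos e0 _ (C.norm_path s)).2 _ e hepos.le hosc
  rw [Real.dist_eq] at hx1 hx2
  rw [intervalIntegral.integral_sub (H η hpos e0 x hxn).1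
    (H η hpos e0 _ (C.norm_path s)).1] at hx2
  set a1 := ∫ τ in (s - η)..(s + η), (m τ - m s) * C.kernel x τ
  set a2 := ∫ τ in (s - η)..(s + η), (m τ - m s) * C.kernel (C.path s) τ
  set n1 := ∫ τ in (s - η)..(s + η), C.kernel x τ
  set n2 := ∫ τ in (s - η)..(s + η), C.kernel (C.path s) τ
  set f1 := ∫ τ in (s + η)..(s - η + C.N), m τ * C.kernel x τ
  set f2 := ∫ τ in (s + η)..(s - η + C.N), m τ * C.kernel (C.path s) τ
  have hrew : a1 + m s * n1 + f1 - (a2 + m s * n2 + f2 + J * m s) =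
      a1 - a2 + m s * (n1 - n2 - J) + (f1 - f2) := by ring
  rw [hrew]
  have h3 : |m s * (n1 - n2 - J)| ≤ |m s| * e := by
    rw [abs_mul]; exact mul_le_mul_of_nonneg_left hx2.le (abs_nonneg _)
  have heε : e * (2 * M + 2 + |m s|) = ε := div_mul_cancel₀ _ hden.ne'
  calc |a1 - a2 + m s * (n1 - n2 - J) + (f1 - f2)|
      ≤ |a1| + |a2| + |m s * (n1 - n2 - J)| + |f1 - f2| :=
        (abs_add_le _ _).trans (add_le_add_left ((abs_add_le _ _).trans
          (add_le_add_left (abs_sub _ _) _)) _)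
    _ < ε := by nlinarith

end SphereCurve

/-! ### Stereographic projection -/

/-- Stereographic projection from `-c`, in the complex coordinate of the frame `(a, c × a)`. -/
def stereo (a c y : E3) : ℂ :=
  ((inner ℝ y a / (1 + inner ℝ y c) : ℝ) : ℂ) +
    ((inner ℝ y (cross c a) / (1 + inner ℝ y c) : ℝ) : ℂ) * Complex.I

/-- The derivative of the stereographic projection at `y` in the direction `v`. -/
def stereoDeriv (a c y v : E3) : ℂ :=
  (((inner ℝ v a * (1 + inner ℝ y c) - inner ℝ y a * inner ℝ v c) /
      (1 + inner ℝ y c) ^ 2 : ℝ) : ℂ) +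
    (((inner ℝ v (cross c a) * (1 + inner ℝ y c) - inner ℝ y (cross c a) * inner ℝ v c) /
      (1 + inner ℝ y c) ^ 2 : ℝ) : ℂ) * Complex.I

/-- The inverse of the stereographic projection. -/
def stereoInverse (a c : E3) (z : ℂ) : E3 :=
  (1 + (z.re ^ 2 + z.im ^ 2))⁻¹ • ((2 * z.re) • a + (2 * z.im) • cross c a +
    (1 - (z.re ^ 2 + z.im ^ 2)) • c)

theorem stereo_re (a c y : E3) : (stereo a c y).re = inner ℝ y a / (1 + inner ℝ y c) := by
  rw [stereo, Complex.add_re, Complex.re_ofReal_mul, Complex.ofReal_re, Complex.I_re,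
    mul_zero, add_zero]

theorem stereo_im (a c y : E3) :
    (stereo a c y).im = inner ℝ y (cross c a) / (1 + inner ℝ y c) := by
  rw [stereo, Complex.add_im, Complex.im_ofReal_mul, Complex.ofReal_im, Complex.I_im,
    mul_one, zero_add]

theorem stereoDeriv_re (a c y v : E3) : (stereoDeriv a c y v).re =
    (inner ℝ v a * (1 + inner ℝ y c) - inner ℝ y a * inner ℝ v c) / (1 + inner ℝ y c) ^ 2 := by
  rw [stereoDeriv, Complex.add_re, Complex.re_ofReal_mul, Complex.ofReal_re, Complex.I_re,
    mul_zero, add_zero]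

theorem stereoDeriv_im (a c y v : E3) : (stereoDeriv a c y v).im =
    (inner ℝ v (cross c a) * (1 + inner ℝ y c) - inner ℝ y (cross c a) * inner ℝ v c) /
      (1 + inner ℝ y c) ^ 2 := by
  rw [stereoDeriv, Complex.add_im, Complex.im_ofReal_mul, Complex.ofReal_im, Complex.I_im,
    mul_one, zero_add]

theorem continuousAt_stereo (a c : E3) {y : E3} (hy : 1 + inner ℝ y c ≠ 0) :
    ContinuousAt (stereo a c) y := by
  unfold stereo
  have h (b : E3) : ContinuousAt (fun y : E3 => inner ℝ y b / (1 + inner ℝ y c)) y :=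
    ContinuousAt.div (by fun_prop) (by fun_prop) hy
  exact (Complex.continuous_ofReal.continuousAt.comp (h a)).add
    ((Complex.continuous_ofReal.continuousAt.comp (h (cross c a))).mul continuousAt_const)

theorem continuousAt_stereoDeriv (a c : E3) {y v : E3} (hy : 1 + inner ℝ y c ≠ 0) :
    ContinuousAt (fun p : E3 × E3 => stereoDeriv a c p.1 p.2) (y, v) := by
  unfold stereoDeriv
  have h (b : E3) : ContinuousAt (fun p : E3 × E3 =>
      (inner ℝ p.2 b * (1 + inner ℝ p.1 c) - inner ℝ p.1 b * inner ℝ p.2 c) /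
        (1 + inner ℝ p.1 c) ^ 2) (y, v) :=
    ContinuousAt.div (by fun_prop) (by fun_prop) (pow_ne_zero 2 hy)
  exact (Complex.continuous_ofReal.continuousAt.comp (h a)).add
    ((Complex.continuous_ofReal.continuousAt.comp (h (cross c a))).mul continuousAt_const)

theorem hasDerivWithinAt_stereo (a c : E3) {f : ℝ → E3} {f' : E3} {S : Set ℝ} {τ : ℝ}
    (hf : HasDerivWithinAt f f' S τ) (hne : 1 + inner ℝ (f τ) c ≠ 0) :
    HasDerivWithinAt (fun τ => stereo a c (f τ)) (stereoDeriv a c (f τ) f') S τ := by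
  have h (b : E3) : HasDerivWithinAt (fun τ => inner ℝ (f τ) b) (inner ℝ f' b) S τ := by
    simpa using hf.inner ℝ (hasDerivWithinAt_const τ S b)
  have hq (b : E3) := ((h b).div ((h c).const_add 1) hne).ofReal_comp
  exact (hq a).add ((hq (cross c a)).mul_const Complex.I)

theorem hasDerivAt_stereo (a c : E3) {f : ℝ → E3} {f' : E3} {τ : ℝ}
    (hf : HasDerivAt f f' τ) (hne : 1 + inner ℝ (f τ) c ≠ 0) :
    HasDerivAt (fun τ => stereo a c (f τ)) (stereoDeriv a c (f τ) f') τ :=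
  hasDerivWithinAt_univ.1 (hasDerivWithinAt_stereo a c hf.hasDerivWithinAt hne)

section Frame

variable {a c : E3}

theorem inner_self_of_norm_one {c : E3} (hc : ‖c‖ = 1) : inner ℝ c c = 1 := by
  rw [real_inner_self_eq_norm_sq, hc, one_pow]

theorem stereo_self (hac : inner ℝ c a = 0) : stereo a c c = 0 := by
  rw [stereo, hac, real_inner_comm (cross c a) c, inner_cross_left_self]
  simp

/-- At the centre the chart reads vectors in the frame `(a, c × a)` and halves them, so angles
between tangents are preserved. -/
theorem stereoDeriv_self (hc : ‖c‖ = 1) (hac : inner ℝ c a = 0) {v : E3} :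
    stereoDeriv a c c v = ⟨inner ℝ v a / 2, inner ℝ v (cross c a) / 2⟩ := by
  have hcc := inner_self_of_norm_one hc
  have hcb : inner ℝ c (cross c a) = 0 := by rw [real_inner_comm, inner_cross_left_self]
  apply Complex.ext
  · rw [stereoDeriv_re, hcc, hac]; norm_num; ring
  · rw [stereoDeriv_im, hcc, hcb]; norm_num; ring

/-- On the unit sphere, 1 + ⟨y, c⟩ = 2 / (1 + |z|²) with z the chart image, so all coordinates of
`y` become rational functions of z. -/
theorem stereo_coordinates (ha : ‖a‖ = 1) (hc : ‖c‖ = 1) (hac : inner ℝ c a = 0) {y : E3}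
    (hy : ‖y‖ = 1) (hne : 1 + inner ℝ y c ≠ 0) :
    (1 + inner ℝ y c) * (1 + ((stereo a c y).re ^ 2 + (stereo a c y).im ^ 2)) = 2 ∧
    inner ℝ y a = (1 + inner ℝ y c) * (stereo a c y).re ∧
    inner ℝ y (cross c a) = (1 + inner ℝ y c) * (stereo a c y).im := by
  have h := inner_eq_frame ha hc hac y y
  rw [inner_self_of_norm_one hy] at h
  rw [stereo_re, stereo_im]
  refine ⟨?_, by field_simp, by field_simp⟩
  field_simp
  nlinarith

theorem inner_stereoInverse (ha : ‖a‖ = 1) (hc : ‖c‖ = 1) (hac : inner ℝ c a = 0)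
    (z : ℂ) : inner ℝ (stereoInverse a c z) a = 2 * z.re / (1 + (z.re ^ 2 + z.im ^ 2)) ∧
    inner ℝ (stereoInverse a c z) (cross c a) = 2 * z.im / (1 + (z.re ^ 2 + z.im ^ 2)) ∧
    inner ℝ (stereoInverse a c z) c =
      (1 - (z.re ^ 2 + z.im ^ 2)) / (1 + (z.re ^ 2 + z.im ^ 2)) := by
  have haa := inner_self_of_norm_one ha
  have hcc := inner_self_of_norm_one hc
  have hca : inner ℝ a c = 0 := by rw [real_inner_comm, hac]
  have hbb : inner ℝ (cross c a) (cross c a) = 1 := by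
    rw [inner_cross_cross, haa, hcc, hac]; ring
  have hab : inner ℝ a (cross c a) = 0 := by rw [real_inner_comm, inner_cross_right_self]
  have hcb : inner ℝ c (cross c a) = 0 := by rw [real_inner_comm, inner_cross_left_self]
  unfold stereoInverse
  simp only [real_inner_smul_left, inner_add_left, haa, hcc, hca, hbb, hab, hcb, hac,
    inner_cross_left_self, inner_cross_right_self]
  refine ⟨?_, ?_, ?_⟩ <;> ring

theorem norm_stereoInverse (ha : ‖a‖ = 1) (hc : ‖c‖ = 1) (hac : inner ℝ c a = 0) (z : ℂ) :
    ‖stereoInverse a c z‖ = 1 := by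
  obtain ⟨h1, h2, h3⟩ := inner_stereoInverse ha hc hac z
  have h := inner_eq_frame ha hc hac (stereoInverse a c z) (stereoInverse a c z)
  rw [h1, h2, h3, real_inner_self_eq_norm_sq] at h
  have hk : 1 + (z.re ^ 2 + z.im ^ 2) ≠ 0 := by positivity
  have : ‖stereoInverse a c z‖ ^ 2 = 1 := by
    rw [h]; field_simp; ring
  exact (pow_eq_one_iff_of_nonneg (norm_nonneg _) two_ne_zero).1 this

theorem stereo_stereoInverse (ha : ‖a‖ = 1) (hc : ‖c‖ = 1) (hac : inner ℝ c a = 0) (z : ℂ) :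
    stereo a c (stereoInverse a c z) = z := by
  obtain ⟨h1, h2, h3⟩ := inner_stereoInverse ha hc hac z
  have hk : 1 + (z.re ^ 2 + z.im ^ 2) ≠ 0 := by positivity
  have e : 1 + (1 - (z.re ^ 2 + z.im ^ 2)) / (1 + (z.re ^ 2 + z.im ^ 2)) =
      2 / (1 + (z.re ^ 2 + z.im ^ 2)) := by field_simp; ring
  apply Complex.ext
  · rw [stereo_re, h1, h3, e]; field_simp
  · rw [stereo_im, h2, h3, e]; field_simp

theorem stereoInverse_stereo (ha : ‖a‖ = 1) (hc : ‖c‖ = 1) (hac : inner ℝ c a = 0) {y : E3}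
    (hy : ‖y‖ = 1) (hne : 1 + inner ℝ y c ≠ 0) : stereoInverse a c (stereo a c y) = y := by
  obtain ⟨h1, h2, h3⟩ := stereo_coordinates ha hc hac hy hne
  obtain ⟨k1, k2, k3⟩ := inner_stereoInverse ha hc hac (stereo a c y)
  rw [frame_decomposition ha hc hac (stereoInverse a c (stereo a c y)), k1, k2, k3]
  conv_rhs => rw [frame_decomposition ha hc hac y]
  set P := (stereo a c y).re
  set Q := (stereo a c y).im
  have hk : 1 + (P ^ 2 + Q ^ 2) ≠ 0 := by positivity
  have e1 : 2 * P / (1 + (P ^ 2 + Q ^ 2)) = inner ℝ y a := by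
    rw [h2, div_eq_iff hk]; linear_combination (-P) * h1
  have e2 : 2 * Q / (1 + (P ^ 2 + Q ^ 2)) = inner ℝ y (cross c a) := by
    rw [h3, div_eq_iff hk]; linear_combination (-Q) * h1
  have e3 : (1 - (P ^ 2 + Q ^ 2)) / (1 + (P ^ 2 + Q ^ 2)) = inner ℝ y c := by
    rw [div_eq_iff hk]; linear_combination -h1
  rw [e1, e2, e3]

theorem continuous_stereoInverse (a c : E3) : Continuous (stereoInverse a c) := by
  unfold stereoInverse
  have h : Continuous fun z : ℂ => (1 + (z.re ^ 2 + z.im ^ 2))⁻¹ :=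
    Continuous.inv₀ (by fun_prop) fun z => by positivity
  exact h.smul (by fun_prop)

/-- The kernel in stereographic coordinates: up to a term that does not depend on `x` it is the
derivative of the argument of `stereo y - stereo x`. -/
theorem inner_cross_div_eq_stereo (ha : ‖a‖ = 1) (hc : ‖c‖ = 1) (hac : inner ℝ c a = 0)
    {x y v : E3} (hx : ‖x‖ = 1) (hy : ‖y‖ = 1) (hxc : 1 + inner ℝ x c ≠ 0)
    (hyc : 1 + inner ℝ y c ≠ 0) (hyv : inner ℝ y v = 0) (hxy : stereo a c y ≠ stereo a c x) :
    inner ℝ (cross x y) v / (1 - inner ℝ x y) / 2 =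
      (stereoDeriv a c y v / (stereo a c y - stereo a c x)).im -
        ((stereo a c y).re * (stereoDeriv a c y v).im -
          (stereo a c y).im * (stereoDeriv a c y v).re) /
          (1 + ((stereo a c y).re ^ 2 + (stereo a c y).im ^ 2)) := by
  obtain ⟨hy1, hy2, hy3⟩ := stereo_coordinates ha hc hac hy hyc
  obtain ⟨hx1, hx2, hx3⟩ := stereo_coordinates ha hc hac hx hxc
  rw [inner_eq_frame ha hc hac] at hyv
  rw [inner_cross_eq_frame ha hc hac, inner_eq_frame ha hc hac x y]
  have hre := stereoDeriv_re a c y v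
  have him := stereoDeriv_im a c y v
  rw [Complex.div_im, Complex.sub_re, Complex.sub_im, Complex.normSq_apply, Complex.sub_re,
    Complex.sub_im]
  have hD : ((stereo a c y).re - (stereo a c x).re) * ((stereo a c y).re - (stereo a c x).re) +
      ((stereo a c y).im - (stereo a c x).im) * ((stereo a c y).im - (stereo a c x).im) ≠ 0 := by
    intro h
    apply hxy
    rw [← sub_eq_zero, ← Complex.normSq_eq_zero, Complex.normSq_apply, Complex.sub_re,
      Complex.sub_im, h]
  set P := (stereo a c y).re
  set Q := (stereo a c y).im
  set U := (stereo a c x).re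
  set W := (stereo a c x).im
  set P' := (stereoDeriv a c y v).re
  set Q' := (stereoDeriv a c y v).im
  rw [hy2, hy3] at hyv
  rw [hy2] at hre
  rw [hy3] at him
  rw [hx2, hx3, hy2, hy3]
  generalize inner ℝ y c = r at *
  generalize inner ℝ x c = t at *
  generalize inner ℝ v a = p at *
  generalize inner ℝ v (cross c a) = q at *
  generalize inner ℝ v c = r' at *
  have hk : 1 + (P ^ 2 + Q ^ 2) ≠ 0 := by positivity
  have hj : 1 + (U ^ 2 + W ^ 2) ≠ 0 := by positivity
  -- All sphere coordinates are now eliminated in favour of chart coordinates: `p` and `q` from the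
  -- chart derivative, `r'` from orthogonality of `y` and `v`, `r` and `t` from the unit norms.
  have ep : p = (1 + r) * P' + r' * P := by rw [hre]; field_simp; ring
  have eq : q = (1 + r) * Q' + r' * Q := by rw [him]; field_simp; ring
  have er' : r' = -(1 + r) ^ 2 * (P * P' + Q * Q') := by
    rw [ep, eq] at hyv
    linear_combination hyv - r' * hy1
  have er : r = 2 / (1 + (P ^ 2 + Q ^ 2)) - 1 := by
    rw [eq_sub_iff_add_eq, eq_div_iff hk]; linarith
  have et : t = 2 / (1 + (U ^ 2 + W ^ 2)) - 1 := by
    rw [eq_sub_iff_add_eq, eq_div_iff hj]; linarith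
  clear_value P Q U W P' Q'
  clear hre him hyv hy1 hx1 hy2 hy3 hx2 hx3 hxy
  -- This is the chordal distance formula for the stereographic projection.
  have hden : 1 - ((1 + t) * U * ((1 + r) * P) + (1 + t) * W * ((1 + r) * Q) + t * r) =
      2 * ((P - U) * (P - U) + (Q - W) * (Q - W)) /
        ((1 + (U ^ 2 + W ^ 2)) * (1 + (P ^ 2 + Q ^ 2))) := by
    rw [er, et]; field_simp; ring
  have hnum : (1 + t) * U * ((1 + r) * Q * r' - r * q) +
      (1 + t) * W * (r * p - (1 + r) * P * r') +
      t * ((1 + r) * P * q - (1 + r) * Q * p) =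
      4 / ((1 + (U ^ 2 + W ^ 2)) * (1 + (P ^ 2 + Q ^ 2))) *
        (Q' * (P - U) - P' * (Q - W) - ((P - U) * (P - U) + (Q - W) * (Q - W)) *
          (P * Q' - Q * P') / (1 + (P ^ 2 + Q ^ 2))) := by
    rw [ep, eq, er', er, et]; field_simp; ring
  rw [hden, hnum]
  generalize (P - U) * (P - U) + (Q - W) * (Q - W) = D at hD ⊢
  field_simp
  ring

end Frame

/-- The argument is the imaginary part of the logarithm, which is differentiable off the branch cut.
-/
theorem hasDerivAt_arg {f : ℝ → ℂ} {f' : ℂ} {τ : ℝ} (hf : HasDerivAt f f' τ)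
    (h : f τ ∈ Complex.slitPlane) : HasDerivAt (fun τ => (f τ).arg) (f' / f τ).im τ := by
  have h1 := Complex.imCLM.hasFDerivAt.comp_hasDerivAt τ (hf.clog_real h)
  simpa only [Function.comp_def, Complex.imCLM_apply, Complex.log_im] using h1

namespace SphereCurve

variable (C : SphereCurve)

/-! ### The jump of the kernel integral over a short piece of the curve -/

/-- The curve in the stereographic chart centred at its point with parameter `s`. -/
def chart (a : E3) (s τ : ℝ) : ℂ := stereo a (C.path s) (C.path τ)

/-- The derivative of the curve in the stereographic chart. -/
def chartDeriv (a : E3) (s τ : ℝ) : ℂ := stereoDeriv a (C.path s) (C.path τ) (deriv C.path τ)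

/-- In the stereographic chart with real direction `a`, the piece of the curve with parameters in
`[s - η, s + η]` is a graph over the real axis. -/
structure IsLocalGraph (s : ℝ) (a : E3) (η : ℝ) : Prop where
  norm_eq_one : ‖a‖ = 1
  inner_eq_zero : inner ℝ (C.path s) a = 0
  right_pos : 0 < inner ℝ (C.rightDeriv s) a
  left_pos : 0 < inner ℝ (C.leftDeriv s) a
  pos : 0 < η
  denom_pos : ∀ τ ∈ Icc (s - η) (s + η), 0 < 1 + inner ℝ (C.path τ) (C.path s)
  differentiableAt : ∀ τ ∈ Ioo (s - η) (s + η), τ ≠ s → DifferentiableAt ℝ C.path τ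
  strictMonoOn : StrictMonoOn (fun τ => (C.chart a s τ).re) (Icc (s - η) (s + η))
  deriv_re_pos : ∀ τ ∈ Ioo (s - η) (s + η), τ ≠ s → 0 < (C.chartDeriv a s τ).re

variable {C}

theorem IsLocalGraph.mono {s η η' : ℝ} {a : E3} (h : C.IsLocalGraph s a η) (hpos : 0 < η')
    (hle : η' ≤ η) : C.IsLocalGraph s a η' := by
  have h1 : Icc (s - η') (s + η') ⊆ Icc (s - η) (s + η) :=
    Icc_subset_Icc (by linarith) (by linarith)
  have h2 : Ioo (s - η') (s + η') ⊆ Ioo (s - η) (s + η) :=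
    Ioo_subset_Ioo (by linarith) (by linarith)
  exact ⟨h.1, h.2, h.3, h.4, hpos, fun τ hτ => h.6 τ (h1 hτ), fun τ hτ => h.7 τ (h2 hτ),
    h.8.mono h1, fun τ hτ => h.9 τ (h2 hτ)⟩

theorem chart_self {s : ℝ} {a : E3} (h : inner ℝ (C.path s) a = 0) : C.chart a s s = 0 :=
  stereo_self h

theorem continuousAt_chart {s τ : ℝ} {a : E3} (h : 1 + inner ℝ (C.path τ) (C.path s) ≠ 0) :
    ContinuousAt (C.chart a s) τ :=
  ContinuousAt.comp (g := stereo a (C.path s)) (continuousAt_stereo _ _ h)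
    C.continuous_path.continuousAt

theorem hasDerivAt_chart {s τ : ℝ} {a : E3} (hd : DifferentiableAt ℝ C.path τ)
    (h : 1 + inner ℝ (C.path τ) (C.path s) ≠ 0) :
    HasDerivAt (C.chart a s) (C.chartDeriv a s τ) τ :=
  hasDerivAt_stereo a (C.path s) hd.hasDerivAt h

theorem one_add_inner_self (s : ℝ) : 1 + inner ℝ (C.path s) (C.path s) = 2 := by
  rw [inner_self_of_norm_one (C.norm_path s)]; norm_num

theorem tendsto_chartDeriv {s : ℝ} {a v : E3} {l : Filter ℝ} (hl : l ≤ 𝓝 s)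
    (hv : Tendsto (deriv C.path) l (𝓝 v)) :
    Tendsto (C.chartDeriv a s) l (𝓝 (stereoDeriv a (C.path s) (C.path s) v)) := by
  have hne : 1 + inner ℝ (C.path s) (C.path s) ≠ 0 := by rw [one_add_inner_self]; norm_num
  have h2 : Tendsto (fun τ => (C.path τ, deriv C.path τ)) l (𝓝 (C.path s, v)) :=
    (C.continuous_path.continuousAt.tendsto.mono_left hl).prodMk_nhds hv
  have h3 := (continuousAt_stereoDeriv a (C.path s) (v := v) hne).tendsto.comp h2
  simp only [Function.comp_def] at h3
  unfold chartDeriv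
  exact h3

variable (C)

/-- Along a transversal direction both one-sided chart velocities at `s` have positive real part,
and by one-sided continuity this persists at nearby parameters other than `s`. Monotonicity is
obtained on each side separately and glued, since `s` may be a corner. -/
theorem exists_isLocalGraph (s : ℝ) : ∃ a η, C.IsLocalGraph s a η := by
  obtain ⟨a, ha, hca, hR, hL⟩ := C.exists_transversal s
  obtain ⟨_, _, η₁, hη₁, hd₁, _⟩ := C.eventually_taylor_right s
  obtain ⟨_, _, η₂, hη₂, hd₂, _⟩ := C.eventually_taylor_left s
  have hr : ∀ᶠ τ in 𝓝[>] s, 0 < (C.chartDeriv a s τ).re := by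
    have h := (Complex.continuous_re.tendsto _).comp
      (tendsto_chartDeriv (a := a) nhdsWithin_le_nhds (C.tendsto_deriv_right s))
    refine h.eventually (lt_mem_nhds ?_)
    rw [stereoDeriv_self (C.norm_path s) hca]
    exact half_pos hR
  have hl : ∀ᶠ τ in 𝓝[<] s, 0 < (C.chartDeriv a s τ).re := by
    have h := (Complex.continuous_re.tendsto _).comp
      (tendsto_chartDeriv (a := a) nhdsWithin_le_nhds (C.tendsto_deriv_left s))
    refine h.eventually (lt_mem_nhds ?_)
    rw [stereoDeriv_self (C.norm_path s) hca]
    exact half_pos hL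
  have hden : ∀ᶠ τ in 𝓝 s, 0 < 1 + inner ℝ (C.path τ) (C.path s) := by
    have hc : Continuous fun τ => 1 + inner ℝ (C.path τ) (C.path s) :=
      continuous_const.add (C.continuous_path.inner continuous_const)
    exact hc.continuousAt.eventually (lt_mem_nhds (by simp only [one_add_inner_self]; norm_num))
  obtain ⟨u, hu, hus⟩ := mem_nhdsGT_iff_exists_Ioo_subset.1 hr
  obtain ⟨v, hv, hvs⟩ := mem_nhdsLT_iff_exists_Ioo_subset.1 hl
  obtain ⟨η₃, hη₃, hden⟩ := Metric.eventually_nhds_iff.1 hden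
  rw [mem_Ioi] at hu
  rw [mem_Iio] at hv
  set η := min (min η₁ η₂) (min (min (u - s) (s - v)) (η₃ / 2)) with hη
  have e1 : η ≤ η₁ := (min_le_left _ _).trans (min_le_left _ _)
  have e2 : η ≤ η₂ := (min_le_left _ _).trans (min_le_right _ _)
  have e3 : η ≤ u - s := (min_le_right _ _).trans ((min_le_left _ _).trans (min_le_left _ _))
  have e4 : η ≤ s - v := (min_le_right _ _).trans ((min_le_left _ _).trans (min_le_right _ _))
  have e5 : η ≤ η₃ / 2 := (min_le_right _ _).trans (min_le_right _ _)
  have hpos : 0 < η := lt_min (lt_min hη₁ hη₂)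
    (lt_min (lt_min (by linarith) (by linarith)) (half_pos hη₃))
  have hden' : ∀ τ ∈ Icc (s - η) (s + η), 0 < 1 + inner ℝ (C.path τ) (C.path s) := by
    intro τ hτ
    refine hden ?_
    rw [Real.dist_eq, abs_lt]
    constructor <;> linarith [hτ.1, hτ.2]
  have hdiff : ∀ τ ∈ Ioo (s - η) (s + η), τ ≠ s → DifferentiableAt ℝ C.path τ := by
    intro τ hτ hne
    rcases lt_or_gt_of_ne hne with h | h
    · exact hd₂ τ ⟨by linarith [hτ.1], h⟩
    · exact hd₁ τ ⟨h, by linarith [hτ.2]⟩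
  have hre : ∀ τ ∈ Ioo (s - η) (s + η), τ ≠ s → 0 < (C.chartDeriv a s τ).re := by
    intro τ hτ hne
    rcases lt_or_gt_of_ne hne with h | h
    · exact hvs ⟨by linarith [hτ.1], h⟩
    · exact hus ⟨h, by linarith [hτ.2]⟩
  have hcont : ContinuousOn (fun τ => (C.chart a s τ).re) (Icc (s - η) (s + η)) := fun τ hτ =>
    (Complex.continuous_re.continuousAt.comp
      (continuousAt_chart (hden' τ hτ).ne')).continuousWithinAt
  have hder : ∀ τ ∈ Ioo (s - η) (s + η), τ ≠ s → 0 < deriv (fun τ => (C.chart a s τ).re) τ := by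
    intro τ hτ hne
    have h1 := Complex.reCLM.hasFDerivAt.comp_hasDerivAt τ
      (hasDerivAt_chart (a := a) (hdiff τ hτ hne) (hden' τ (Ioo_subset_Icc_self hτ)).ne')
    have h2 : HasDerivAt (fun τ => (C.chart a s τ).re) (C.chartDeriv a s τ).re τ := h1
    rw [h2.deriv]
    exact hre τ hτ hne
  have m1 : StrictMonoOn (fun τ => (C.chart a s τ).re) (Icc (s - η) s) :=
    strictMonoOn_of_deriv_pos (convex_Icc _ _)
      (hcont.mono (Icc_subset_Icc_right (by linarith))) fun τ hτ => by
        rw [interior_Icc] at hτ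
        exact hder τ ⟨hτ.1, by linarith [hτ.2]⟩ hτ.2.ne
  have m2 : StrictMonoOn (fun τ => (C.chart a s τ).re) (Icc s (s + η)) :=
    strictMonoOn_of_deriv_pos (convex_Icc _ _)
      (hcont.mono (Icc_subset_Icc_left (by linarith))) fun τ hτ => by
        rw [interior_Icc] at hτ
        exact hder τ ⟨by linarith [hτ.1], hτ.2⟩ hτ.1.ne'
  have m3 := m1.union m2 (isGreatest_Icc (by linarith)) (isLeast_Icc (by linarith))
  rw [Icc_union_Icc_eq_Icc (by linarith) (by linarith)] at m3
  exact ⟨a, η, ha, hca, hR, hL, hpos, hden', hdiff, m3, hre⟩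

variable {C}

namespace IsLocalGraph

variable {s η : ℝ} {a : E3}

theorem chart_re_pos (h : C.IsLocalGraph s a η) {τ : ℝ} (h1 : s < τ) (h2 : τ ≤ s + η) :
    0 < (C.chart a s τ).re := by
  have := h.strictMonoOn ⟨by linarith [h.pos], by linarith [h.pos]⟩
    ⟨by linarith [h.pos], h2⟩ h1
  simpa [chart_self h.inner_eq_zero] using this

theorem chart_re_neg (h : C.IsLocalGraph s a η) {τ : ℝ} (h1 : τ < s) (h2 : s - η ≤ τ) :
    (C.chart a s τ).re < 0 := by
  have := h.strictMonoOn ⟨h2, by linarith [h.pos]⟩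
    ⟨by linarith [h.pos], by linarith [h.pos]⟩ h1
  simpa [chart_self h.inner_eq_zero] using this

/-- The difference of the kernels at `x` and at the centre of the chart. -/
theorem two_pi_mul_kernel_sub (h : C.IsLocalGraph s a η) {x : E3} (hx : ‖x‖ = 1)
    (hxc : 1 + inner ℝ x (C.path s) ≠ 0) {τ : ℝ} (hτ : τ ∈ Ioo (s - η) (s + η)) (hne : τ ≠ s)
    (hY : C.chart a s τ ≠ stereo a (C.path s) x) :
    2 * Real.pi * (C.kernel x τ - C.kernel (C.path s) τ) =
      (C.chartDeriv a s τ / (C.chart a s τ - stereo a (C.path s) x)).im -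
        (C.chartDeriv a s τ / C.chart a s τ).im := by
  have hτ' := Ioo_subset_Icc_self hτ
  have hY0 : C.chart a s τ ≠ 0 := by
    intro h0
    rcases lt_or_gt_of_ne hne with hlt | hlt
    · have := h.chart_re_neg hlt hτ'.1
      rw [h0] at this; simp at this
    · have := h.chart_re_pos hlt hτ'.2
      rw [h0] at this; simp at this
  -- The same identity is used for `x` and for the centre; its term free of `x` cancels in the
  -- difference.
  have k1 := inner_cross_div_eq_stereo h.norm_eq_one (C.norm_path s) h.inner_eq_zero hx
    (C.norm_path τ) hxc (h.denom_pos τ hτ').ne' (C.inner_path_deriv τ) hY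
  have k2 := inner_cross_div_eq_stereo h.norm_eq_one (C.norm_path s) h.inner_eq_zero
    (C.norm_path s) (C.norm_path τ) (by rw [one_add_inner_self]; norm_num)
    (h.denom_pos τ hτ').ne' (C.inner_path_deriv τ)
    (by rw [stereo_self h.inner_eq_zero]; exact hY0)
  rw [stereo_self h.inner_eq_zero, sub_zero] at k2
  have e (z : E3) : 2 * Real.pi * C.kernel z τ =
      inner ℝ (cross z (C.path τ)) (deriv C.path τ) / (1 - inner ℝ z (C.path τ)) / 2 := by
    rw [kernel]; field_simp; norm_num
  rw [mul_sub, e, e, k1, k2, chart, chartDeriv]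
  ring

theorem hasDerivWithinAt_chart_right (h : C.IsLocalGraph s a η) :
    HasDerivWithinAt (C.chart a s) (stereoDeriv a (C.path s) (C.path s) (C.rightDeriv s))
      (Ici s) s :=
  hasDerivWithinAt_stereo a (C.path s) (C.hasDerivWithinAt_rightDeriv s)
    (h.denom_pos s ⟨by linarith [h.pos], by linarith [h.pos]⟩).ne'

theorem hasDerivWithinAt_chart_left (h : C.IsLocalGraph s a η) :
    HasDerivWithinAt (C.chart a s) (stereoDeriv a (C.path s) (C.path s) (C.leftDeriv s))
      (Iic s) s :=
  hasDerivWithinAt_stereo a (C.path s) (C.hasDerivWithinAt_leftDeriv s)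
    (h.denom_pos s ⟨by linarith [h.pos], by linarith [h.pos]⟩).ne'

theorem rightDeriv_re_pos (h : C.IsLocalGraph s a η) :
    0 < (stereoDeriv a (C.path s) (C.path s) (C.rightDeriv s)).re := by
  rw [stereoDeriv_self (C.norm_path s) h.inner_eq_zero]
  exact half_pos h.right_pos

theorem leftDeriv_re_pos (h : C.IsLocalGraph s a η) :
    0 < (stereoDeriv a (C.path s) (C.path s) (C.leftDeriv s)).re := by
  rw [stereoDeriv_self (C.norm_path s) h.inner_eq_zero]
  exact half_pos h.left_pos

/-- The argument ignores positive factors, so the chart point may be replaced by its difference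
quotient at `s`. That tends to the one-sided derivative, which lies in the right half-plane where
the argument is continuous. -/
theorem tendsto_arg_right (h : C.IsLocalGraph s a η) :
    Tendsto (fun τ => (C.chart a s τ).arg) (𝓝[>] s)
      (𝓝 (stereoDeriv a (C.path s) (C.path s) (C.rightDeriv s)).arg) := by
  have h1 := (hasDerivWithinAt_iff_tendsto_slope' self_notMem_Ioi).1
    (h.hasDerivWithinAt_chart_right.mono Ioi_subset_Ici_self)
  have h2 := (Complex.continuousAt_arg (Or.inl h.rightDeriv_re_pos)).tendsto.comp h1
  refine h2.congr' ?_
  filter_upwards [self_mem_nhdsWithin] with τ hτ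
  rw [mem_Ioi] at hτ
  rw [Function.comp_apply, slope_def_module, chart_self h.inner_eq_zero, sub_zero,
    Complex.real_smul, Complex.arg_real_mul _ (inv_pos.2 (sub_pos.2 hτ))]

theorem tendsto_arg_left (h : C.IsLocalGraph s a η) :
    Tendsto (fun τ => (-C.chart a s τ).arg) (𝓝[<] s)
      (𝓝 (stereoDeriv a (C.path s) (C.path s) (C.leftDeriv s)).arg) := by
  have h1 := (hasDerivWithinAt_iff_tendsto_slope' self_notMem_Iio).1
    (h.hasDerivWithinAt_chart_left.mono Iio_subset_Iic_self)
  have h2 := (Complex.continuousAt_arg (Or.inl h.leftDeriv_re_pos)).tendsto.comp h1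
  refine h2.congr' ?_
  filter_upwards [self_mem_nhdsWithin] with τ hτ
  rw [mem_Iio] at hτ
  -- Left of `s` the increment of the parameter is negative, hence the sign in front of the chart
  -- point.
  have e : (τ - s)⁻¹ • C.chart a s τ = (((s - τ)⁻¹ : ℝ) : ℂ) * (-C.chart a s τ) := by
    rw [Complex.real_smul, ← neg_sub s τ, inv_neg]
    push_cast; ring
  rw [Function.comp_apply, slope_def_module, chart_self h.inner_eq_zero, sub_zero, e,
    Complex.arg_real_mul _ (inv_pos.2 (sub_pos.2 hτ))]

/-- If a rotated slit plane contains the curve as seen from `x`, then the difference of the kernel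
integrals is the variation of an explicit argument. -/
theorem integral_kernel_sub (h : C.IsLocalGraph s a η) {x : E3} (hx : ‖x‖ = 1)
    (hxc : 1 + inner ℝ x (C.path s) ≠ 0) (u : ℂ)
    (hu : ∀ τ ∈ Icc (s - η) (s + η),
      u * (C.chart a s τ - stereo a (C.path s) x) ∈ Complex.slitPlane)
    (hix : IntervalIntegrable (C.kernel x) volume (s - η) (s + η)) :
    2 * Real.pi * ∫ τ in (s - η)..(s + η), (C.kernel x τ - C.kernel (C.path s) τ) =
      (u * (C.chart a s (s + η) - stereo a (C.path s) x)).arg - (C.chart a s (s + η)).arg +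
      (stereoDeriv a (C.path s) (C.path s) (C.rightDeriv s)).arg -
      (stereoDeriv a (C.path s) (C.path s) (C.leftDeriv s)).arg -
      (u * (C.chart a s (s - η) - stereo a (C.path s) x)).arg + (-C.chart a s (s - η)).arg := by
  have hη := h.pos
  set X := stereo a (C.path s) x with hX
  set Y := C.chart a s with hY
  have hu0 : u ≠ 0 := by
    rintro rfl
    have := hu s ⟨by linarith, by linarith⟩
    rw [zero_mul] at this
    exact Complex.zero_notMem_slitPlane this
  have hYX : ∀ τ ∈ Icc (s - η) (s + η), Y τ ≠ X := by
    intro τ hτ he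
    have := hu τ hτ
    rw [he, sub_self, mul_zero] at this
    exact Complex.zero_notMem_slitPlane this
  have hcont : ∀ τ ∈ Icc (s - η) (s + η), ContinuousAt Y τ := fun τ hτ =>
    continuousAt_chart (h.denom_pos τ hτ).ne'
  have hargc : ∀ τ ∈ Icc (s - η) (s + η), ContinuousAt (fun τ => (u * (Y τ - X)).arg) τ :=
    fun τ hτ => ContinuousAt.comp (g := Complex.arg) (Complex.continuousAt_arg (hu τ hτ))
      (continuousAt_const.mul ((hcont τ hτ).sub continuousAt_const))
  have hdarg : ∀ τ ∈ Ioo (s - η) (s + η), τ ≠ s →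
      HasDerivAt (fun τ => (u * (Y τ - X)).arg) (C.chartDeriv a s τ / (Y τ - X)).im τ := by
    intro τ hτ hne
    have hτ' := Ioo_subset_Icc_self hτ
    have h1 := hasDerivAt_chart (a := a) (h.differentiableAt τ hτ hne) (h.denom_pos τ hτ').ne'
    have h2 := hasDerivAt_arg ((h1.sub_const X).const_mul u) (hu τ hτ')
    rwa [mul_div_mul_left _ _ hu0] at h2
  have hki : IntervalIntegrable (fun τ => C.kernel x τ - C.kernel (C.path s) τ) volume
      (s - η) (s + η) := hix.sub (C.intervalIntegrable_kernel_self s _ _)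
  have hki' := hki.const_mul (2 * Real.pi)
  have hs : s ∈ Icc (s - η) (s + η) := ⟨by linarith, by linarith⟩
  have hmem : s ∈ uIcc (s - η) (s + η) := by rw [uIcc_of_le (by linarith)]; exact hs
  have hkiL := hki'.mono_set (uIcc_subset_uIcc_left hmem)
  have hkiR := hki'.mono_set (uIcc_subset_uIcc_right hmem)
  -- The integral is split at `s`: there the curve may have a corner and `Y` vanishes. To the right
  -- `Y`, to the left `-Y`, lies in the right half-plane, so its argument is a smooth primitive.
  rw [← intervalIntegral.integral_const_mul,
    ← intervalIntegral.integral_add_adjacent_intervals hkiL hkiR]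
  have hB : ContinuousAt (fun τ => (Y τ).arg) (s + η) :=
    ContinuousAt.comp (g := Complex.arg)
      (Complex.continuousAt_arg (Or.inl (h.chart_re_pos (by linarith) le_rfl)))
      (hcont _ ⟨by linarith, le_rfl⟩)
  have hA : ContinuousAt (fun τ => (-Y τ).arg) (s - η) := by
    refine ContinuousAt.comp (g := Complex.arg) (Complex.continuousAt_arg (Or.inl ?_))
      (hcont _ ⟨le_rfl, by linarith⟩).neg
    have := h.chart_re_neg (τ := s - η) (by linarith) le_rfl
    simpa using this
  have hR : ∫ τ in s..(s + η), 2 * Real.pi * (C.kernel x τ - C.kernel (C.path s) τ) =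
      ((u * (Y (s + η) - X)).arg - (Y (s + η)).arg) - ((u * (Y s - X)).arg -
        (stereoDeriv a (C.path s) (C.path s) (C.rightDeriv s)).arg) := by
    refine intervalIntegral.integral_eq_sub_of_hasDerivAt_of_tendsto
      (f := fun τ => (u * (Y τ - X)).arg - (Y τ).arg) (by linarith) ?_ hkiR ?_ ?_
    · intro τ hτ
      have hτ1 : τ ∈ Ioo (s - η) (s + η) := ⟨by linarith [hτ.1], hτ.2⟩
      have hne : τ ≠ s := hτ.1.ne'
      rw [h.two_pi_mul_kernel_sub hx hxc hτ1 hne (hYX τ (Ioo_subset_Icc_self hτ1))]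
      have h1 := hasDerivAt_chart (a := a) (h.differentiableAt τ hτ1 hne)
        (h.denom_pos τ (Ioo_subset_Icc_self hτ1)).ne'
      exact (hdarg τ hτ1 hne).sub
        (hasDerivAt_arg h1 (Or.inl (h.chart_re_pos hτ.1 hτ.2.le)))
    · exact ((hargc s hs).tendsto.mono_left nhdsWithin_le_nhds).sub h.tendsto_arg_right
    · exact ((hargc _ ⟨by linarith, le_rfl⟩).sub hB).tendsto.mono_left nhdsWithin_le_nhds
  have hL : ∫ τ in (s - η)..s, 2 * Real.pi * (C.kernel x τ - C.kernel (C.path s) τ) =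
      ((u * (Y s - X)).arg - (stereoDeriv a (C.path s) (C.path s) (C.leftDeriv s)).arg) -
      ((u * (Y (s - η) - X)).arg - (-Y (s - η)).arg) := by
    refine intervalIntegral.integral_eq_sub_of_hasDerivAt_of_tendsto
      (f := fun τ => (u * (Y τ - X)).arg - (-Y τ).arg) (by linarith) ?_ hkiL ?_ ?_
    · intro τ hτ
      have hτ1 : τ ∈ Ioo (s - η) (s + η) := ⟨hτ.1, by linarith [hτ.2]⟩
      have hne : τ ≠ s := hτ.2.ne
      rw [h.two_pi_mul_kernel_sub hx hxc hτ1 hne (hYX τ (Ioo_subset_Icc_self hτ1))]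
      have h1 := hasDerivAt_chart (a := a) (h.differentiableAt τ hτ1 hne)
        (h.denom_pos τ (Ioo_subset_Icc_self hτ1)).ne'
      have hm : -Y τ ∈ Complex.slitPlane := by
        have := h.chart_re_neg hτ.2 hτ.1.le
        exact Or.inl (by simpa using this)
      have h2 : HasDerivAt (fun τ => (-Y τ).arg) (-C.chartDeriv a s τ / -Y τ).im τ :=
        hasDerivAt_arg h1.neg hm
      rw [neg_div_neg_eq] at h2
      exact (hdarg τ hτ1 hne).sub h2
    · exact ((hargc _ ⟨le_rfl, by linarith⟩).sub hA).tendsto.mono_left nhdsWithin_le_nhds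
    · exact ((hargc s hs).tendsto.mono_left nhdsWithin_le_nhds).sub h.tendsto_arg_left
  -- The two occurrences of the argument of `u * (Y s - X)` cancel, so the behaviour of `x` relative
  -- to the corner leaves no trace.
  rw [hR, hL]
  ring

end IsLocalGraph

/-- The argument lies in (-π/2, π/2), so a quarter turn does not cross the branch cut. -/
theorem arg_I_mul_of_re_pos {z : ℂ} (hz : 0 < z.re) :
    (Complex.I * z).arg = z.arg + Real.pi / 2 := by
  have hz0 : z ≠ 0 := by rintro rfl; simp at hz
  have h := abs_lt.1 (Complex.abs_arg_lt_pi_div_two_iff.2 (Or.inl hz))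
  rw [Complex.arg_mul Complex.I_ne_zero hz0, Complex.arg_I, add_comm]
  rw [Complex.arg_I]
  constructor <;> linarith [Real.pi_pos]

theorem arg_neg_I_mul_of_re_pos {z : ℂ} (hz : 0 < z.re) :
    (-Complex.I * z).arg = z.arg - Real.pi / 2 := by
  have hz0 : z ≠ 0 := by rintro rfl; simp at hz
  have h := abs_lt.1 (Complex.abs_arg_lt_pi_div_two_iff.2 (Or.inl hz))
  rw [Complex.arg_mul (neg_ne_zero.2 Complex.I_ne_zero) hz0, Complex.arg_neg_I]
  · ring
  · rw [Complex.arg_neg_I]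
    constructor <;> linarith [Real.pi_pos]

theorem tendsto_arg_mul_sub {D : Set Sphere2} {x₀ : Sphere2} {a : E3}
    (hac : inner ℝ (x₀ : E3) a = 0) {u z : ℂ} (h : u * z ∈ Complex.slitPlane) :
    Tendsto (fun x : Sphere2 => (u * (z - stereo a x₀ x)).arg) (𝓝[D] x₀) (𝓝 (u * z).arg) := by
  have hx₀ : ‖(x₀ : E3)‖ = 1 := by simp
  have h1 : Tendsto (fun x : Sphere2 => stereo a x₀ x) (𝓝[D] x₀) (𝓝 0) := by
    have hc := continuousAt_stereo a (x₀ : E3) (y := x₀)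
      (by rw [inner_self_of_norm_one hx₀]; norm_num)
    have := hc.tendsto.comp (continuous_subtype_val.continuousAt (x := x₀)).tendsto
    rw [stereo_self hac] at this
    exact this.mono_left nhdsWithin_le_nhds
  have h2 : Tendsto (fun x : Sphere2 => u * (z - stereo a x₀ x)) (𝓝[D] x₀) (𝓝 (u * z)) := by
    simpa using (tendsto_const_nhds.sub h1).const_mul u
  exact (Complex.continuousAt_arg h).tendsto.comp h2

variable {s η : ℝ} {a : E3}

theorem eventually_one_add_inner_ne (x₀ : Sphere2) (D : Set Sphere2) :
    ∀ᶠ x : Sphere2 in 𝓝[D] x₀, 1 + inner ℝ (x : E3) (x₀ : E3) ≠ 0 := by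
  have hc : Continuous fun x : Sphere2 => 1 + inner ℝ (x : E3) (x₀ : E3) :=
    continuous_const.add (continuous_subtype_val.inner continuous_const)
  refine nhdsWithin_le_nhds (hc.continuousAt.eventually_ne ?_)
  rw [inner_self_of_norm_one (by simp)]; norm_num

/-- In `integral_kernel_sub` the point `x` enters only through two endpoint arguments. These are
continuous as `stereo a (C.path s) x` tends to 0. -/
theorem IsLocalGraph.tendsto_integral_of_slitPlane (h : C.IsLocalGraph s a η) {D : Set Sphere2}
    (hi : ∀ x : E3, ‖x‖ = 1 → IntervalIntegrable (C.kernel x) volume (s - η) (s + η)) {u : ℂ}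
    (hB : u * C.chart a s (s + η) ∈ Complex.slitPlane)
    (hA : u * C.chart a s (s - η) ∈ Complex.slitPlane)
    (hD : ∀ᶠ x : Sphere2 in 𝓝[D] (C.pt s), ∀ τ ∈ Icc (s - η) (s + η),
      u * (C.chart a s τ - stereo a (C.path s) x) ∈ Complex.slitPlane) :
    Tendsto (fun x : Sphere2 => ∫ τ in (s - η)..(s + η),
      (C.kernel x τ - C.kernel (C.path s) τ)) (𝓝[D] (C.pt s))
      (𝓝 ((2 * Real.pi)⁻¹ * ((u * C.chart a s (s + η)).arg - (C.chart a s (s + η)).arg +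
        (stereoDeriv a (C.path s) (C.path s) (C.rightDeriv s)).arg -
        (stereoDeriv a (C.path s) (C.path s) (C.leftDeriv s)).arg -
        (u * C.chart a s (s - η)).arg + (-C.chart a s (s - η)).arg))) := by
  have l1 := tendsto_arg_mul_sub (D := D) (x₀ := C.pt s) h.inner_eq_zero hB
  have l2 := tendsto_arg_mul_sub (D := D) (x₀ := C.pt s) h.inner_eq_zero hA
  have l3 := (((((l1.sub_const (C.chart a s (s + η)).arg).add_const
    (stereoDeriv a (C.path s) (C.path s) (C.rightDeriv s)).arg).sub_const
    (stereoDeriv a (C.path s) (C.path s) (C.leftDeriv s)).arg).sub l2).add_const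
    (-C.chart a s (s - η)).arg).const_mul (2 * Real.pi)⁻¹
  refine l3.congr' ?_
  filter_upwards [hD, eventually_one_add_inner_ne (C.pt s) D] with x hx hne
  rw [inv_mul_eq_iff_eq_mul₀ (by positivity)]
  exact (h.integral_kernel_sub (by simp) hne u hx (hi x (by simp))).symm

/-- Local jump from the side above the graph. -/
theorem IsLocalGraph.tendsto_integral_above (h : C.IsLocalGraph s a η) {D : Set Sphere2}
    (hi : ∀ x : E3, ‖x‖ = 1 → IntervalIntegrable (C.kernel x) volume (s - η) (s + η))
    (hD : ∀ᶠ x : Sphere2 in 𝓝[D] (C.pt s), ∀ τ ∈ Icc (s - η) (s + η),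
      (C.chart a s τ).re = (stereo a (C.path s) x).re →
        (C.chart a s τ).im < (stereo a (C.path s) x).im) :
    Tendsto (fun x : Sphere2 => ∫ τ in (s - η)..(s + η),
      (C.kernel x τ - C.kernel (C.path s) τ)) (𝓝[D] (C.pt s))
      (𝓝 ((2 * Real.pi)⁻¹ * (Real.pi +
        (stereoDeriv a (C.path s) (C.path s) (C.rightDeriv s)).arg -
        (stereoDeriv a (C.path s) (C.path s) (C.leftDeriv s)).arg))) := by
  have hη := h.pos
  have hB := h.chart_re_pos (τ := s + η) (by linarith) le_rfl
  have hA := h.chart_re_neg (τ := s - η) (by linarith) le_rfl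
  have hA' : 0 < (-C.chart a s (s - η)).re := by simpa using hA
  have eA : Complex.I * C.chart a s (s - η) = -Complex.I * -C.chart a s (s - η) := by ring
  -- If `x` is above the graph, `Y - X` never lies on the nonnegative imaginary axis; multiplication
  -- by `I` turns that ray into the branch cut. The quarter turns at the two endpoints then add up
  -- to π.
  have l := h.tendsto_integral_of_slitPlane hi (D := D) (u := Complex.I)
    (Or.inr (by simpa using hB.ne')) (Or.inr (by simpa using hA.ne)) (by
      filter_upwards [hD] with x hx τ hτ
      by_cases he : (C.chart a s τ).re = (stereo a (C.path s) x).re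
      · exact Or.inl (by simpa using hx τ hτ he)
      · exact Or.inr (by simpa [sub_eq_zero] using he))
  rw [arg_I_mul_of_re_pos hB, eA, arg_neg_I_mul_of_re_pos hA'] at l
  convert l using 3
  ring

/-- Local jump from the side below the graph. -/
theorem IsLocalGraph.tendsto_integral_below (h : C.IsLocalGraph s a η) {D : Set Sphere2}
    (hi : ∀ x : E3, ‖x‖ = 1 → IntervalIntegrable (C.kernel x) volume (s - η) (s + η))
    (hD : ∀ᶠ x : Sphere2 in 𝓝[D] (C.pt s), ∀ τ ∈ Icc (s - η) (s + η),
      (C.chart a s τ).re = (stereo a (C.path s) x).re →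
        (stereo a (C.path s) x).im < (C.chart a s τ).im) :
    Tendsto (fun x : Sphere2 => ∫ τ in (s - η)..(s + η),
      (C.kernel x τ - C.kernel (C.path s) τ)) (𝓝[D] (C.pt s))
      (𝓝 ((2 * Real.pi)⁻¹ * (-Real.pi +
        (stereoDeriv a (C.path s) (C.path s) (C.rightDeriv s)).arg -
        (stereoDeriv a (C.path s) (C.path s) (C.leftDeriv s)).arg))) := by
  have hη := h.pos
  have hB := h.chart_re_pos (τ := s + η) (by linarith) le_rfl
  have hA := h.chart_re_neg (τ := s - η) (by linarith) le_rfl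
  have hA' : 0 < (-C.chart a s (s - η)).re := by simpa using hA
  have eA : -Complex.I * C.chart a s (s - η) = Complex.I * -C.chart a s (s - η) := by ring
  -- Mirror image: the forbidden ray now points down, `-I` takes it to the branch cut, and the
  -- quarter turns add up to -π.
  have l := h.tendsto_integral_of_slitPlane hi (D := D) (u := -Complex.I)
    (Or.inr (by simpa using hB.ne')) (Or.inr (by simpa using hA.ne)) (by
      filter_upwards [hD] with x hx τ hτ
      by_cases he : (C.chart a s τ).re = (stereo a (C.path s) x).re
      · exact Or.inl (by simpa using hx τ hτ he)
      · exact Or.inr (by simpa [sub_eq_zero] using Ne.symm he))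
  rw [arg_neg_I_mul_of_re_pos hB, eA, arg_I_mul_of_re_pos hA'] at l
  convert l using 3
  ring

end SphereCurve

/-! ### Normal displacement from a graph, and conformality of the chart -/

theorem abs_im_mul_re_sub_le (z v : ℂ) : |z.im * v.re - z.re * v.im| ≤ ‖z‖ * ‖v‖ := by
  have h : z.im * v.re - z.re * v.im = (z * (starRingEnd ℂ) v).im := by
    simp only [Complex.mul_im, Complex.conj_re, Complex.conj_im]; ring
  rw [h]
  refine (Complex.abs_im_le_norm _).trans ?_
  rw [norm_mul, Complex.norm_conj]

/-- A point that leaves a planar graph in the direction of its left normal lies above the graph. -/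
theorem eventually_above_of_normal {Y X : ℝ → ℂ} {A B s₁ k : ℝ} {v : ℂ}
    (hmono : StrictMonoOn (fun τ => (Y τ).re) (Icc A B)) (hs₁ : s₁ ∈ Ioo A B)
    (hY : HasDerivAt Y v s₁) (hv : 0 < v.re) (hk : 0 < k)
    (hX : HasDerivAt X (k * Complex.I * v) 0) (hXY : X 0 = Y s₁) :
    ∀ᶠ δ in 𝓝[>] (0 : ℝ), ∀ τ ∈ Icc A B, (Y τ).re = (X δ).re → (Y τ).im < (X δ).im := by
  have hn : 0 < ‖v‖ := norm_pos_iff.2 (by rintro rfl; simp at hv)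
  have h1 : ∀ᶠ τ in 𝓝 s₁, ‖Y τ - Y s₁ - (τ - s₁) • v‖ ≤ v.re / 16 * ‖τ - s₁‖ :=
    (hasDerivAt_iff_isLittleO.1 hY).def (by positivity)
  obtain ⟨ρ, hρ, hρY⟩ := Metric.eventually_nhds_iff.1 h1
  have h2 : ∀ᶠ δ in 𝓝 (0 : ℝ), ‖X δ - X 0 - (δ - 0) • (k * Complex.I * v)‖ ≤
      k * ‖v‖ / 2 * ‖δ - 0‖ := (hasDerivAt_iff_isLittleO.1 hX).def (by positivity)
  -- Since the real part is strictly monotone, any graph point over `X δ` has its parameter between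
  -- `p` and `q` once δ is small, hence within the range of the first-order expansion of `Y`.
  set p := max A (s₁ - ρ / 2) with hp
  set q := min B (s₁ + ρ / 2) with hq
  have hpA : A ≤ p := le_max_left _ _
  have hqB : q ≤ B := min_le_left _ _
  have hps : p < s₁ := max_lt hs₁.1 (by linarith)
  have hsq : s₁ < q := lt_min hs₁.2 (by linarith)
  have hpm : p ∈ Icc A B := ⟨hpA, by linarith⟩
  have hqm : q ∈ Icc A B := ⟨by linarith, hqB⟩
  have hsm : s₁ ∈ Icc A B := Ioo_subset_Icc_self hs₁
  have hXre : Tendsto (fun δ => (X δ).re) (𝓝 0) (𝓝 (Y s₁).re) := by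
    rw [← hXY]
    exact (Complex.continuous_re.tendsto _).comp hX.continuousAt.tendsto
  have h3 : ∀ᶠ δ in 𝓝 (0 : ℝ), (Y p).re < (X δ).re :=
    hXre.eventually (lt_mem_nhds (hmono hpm hsm hps))
  have h4 : ∀ᶠ δ in 𝓝 (0 : ℝ), (X δ).re < (Y q).re :=
    hXre.eventually (gt_mem_nhds (hmono hsm hqm hsq))
  filter_upwards [self_mem_nhdsWithin, nhdsWithin_le_nhds h2, nhdsWithin_le_nhds h3,
    nhdsWithin_le_nhds h4] with δ hδ e2 e3 e4 τ hτ hre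
  rw [mem_Ioi] at hδ
  by_contra hcon
  rw [not_lt] at hcon
  have hpτ : p < τ := by
    by_contra hle
    have := hmono.monotoneOn hτ hpm (not_lt.1 hle)
    linarith
  have hτq : τ < q := by
    by_contra hle
    have := hmono.monotoneOn hqm hτ (not_lt.1 hle)
    linarith
  have hdist : dist τ s₁ < ρ := by
    rw [Real.dist_eq, abs_lt]
    have : s₁ - ρ / 2 ≤ p := le_max_right _ _
    have : q ≤ s₁ + ρ / 2 := min_le_right _ _
    constructor <;> linarith
  have eY := hρY hdist
  rw [hXY, sub_zero, Real.norm_of_nonneg hδ.le] at e2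
  rw [Real.norm_eq_abs] at eY
  set R := Y τ - Y s₁ - (τ - s₁) • v with hR
  set Q := X δ - Y s₁ - δ • (k * Complex.I * v) with hQ
  have eQre : Q.re = (X δ).re - (Y s₁).re + δ * k * v.im := by
    simp [hQ]; ring
  have eQim : Q.im = (X δ).im - (Y s₁).im - δ * k * v.re := by
    simp [hQ]; ring
  have eRre : R.re = (Y τ).re - (Y s₁).re - (τ - s₁) * v.re := by simp [hR]
  have eRim : R.im = (Y τ).im - (Y s₁).im - (τ - s₁) * v.im := by simp [hR]
  -- The quantities bounded here are ‖v‖ times the components of the remainders along the left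
  -- normal `I * v`.
  have bR := abs_le.1 (abs_im_mul_re_sub_le R v)
  have bQ := abs_le.1 (abs_im_mul_re_sub_le Q v)
  have hnsq : ‖v‖ ^ 2 = v.re ^ 2 + v.im ^ 2 := by
    rw [← Complex.normSq_eq_norm_sq, Complex.normSq_apply]; ring
  have hXd : |(X δ).re - (Y s₁).re| ≤ 2 * (k * ‖v‖ * δ) := by
    have h5 : (X δ).re - (Y s₁).re = Q.re - δ * k * v.im := by rw [eQre]; ring
    have h6 := (Complex.abs_re_le_norm Q).trans e2
    have h7 : |δ * k * v.im| ≤ δ * k * ‖v‖ := by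
      rw [abs_mul, abs_of_pos (by positivity : 0 < δ * k)]
      exact mul_le_mul_of_nonneg_left (Complex.abs_im_le_norm v) (by positivity)
    have h8 : 0 ≤ k * ‖v‖ * δ := by positivity
    rw [h5]
    refine (abs_sub _ _).trans ?_
    linarith
  -- Equality of real parts ties `τ - s₁` to the displacement of `X`, so it is O(δ).
  have hτd : v.re * |τ - s₁| ≤ 4 * (k * ‖v‖ * δ) := by
    have h5 : v.re * |τ - s₁| = |(X δ).re - (Y s₁).re - R.re| := by
      rw [eRre, hre, ← abs_of_pos hv, ← abs_mul, abs_of_pos hv]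
      congr 1; ring
    have h6 := abs_sub ((X δ).re - (Y s₁).re) R.re
    have h7 := (Complex.abs_re_le_norm R).trans eY
    have h8 : 0 ≤ k * ‖v‖ * δ := by positivity
    linarith
  -- To first order `X δ` is ahead by δ k ‖v‖² in the normal component. The remainders can make up
  -- at most 1/4 + 1/2 of this, which contradicts `X δ` not being above the graph.
  have hsum : (R.im * v.re - R.re * v.im) - (Q.im * v.re - Q.re * v.im) =
      ((Y τ).im - (X δ).im) * v.re + δ * k * ‖v‖ ^ 2 := by
    rw [eRre, eRim, eQre, eQim, hre, hnsq]; ring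
  have h9 : 0 ≤ ((Y τ).im - (X δ).im) * v.re := mul_nonneg (by linarith) hv.le
  have h10 : ‖R‖ * ‖v‖ ≤ k * ‖v‖ ^ 2 * δ / 4 := by
    calc ‖R‖ * ‖v‖ ≤ (v.re / 16 * |τ - s₁|) * ‖v‖ := by gcongr
      _ = (v.re * |τ - s₁|) * ‖v‖ / 16 := by ring
      _ ≤ (4 * (k * ‖v‖ * δ)) * ‖v‖ / 16 := by gcongr
      _ = k * ‖v‖ ^ 2 * δ / 4 := by ring
  have h11 : ‖Q‖ * ‖v‖ ≤ k * ‖v‖ ^ 2 * δ / 2 := by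
    calc ‖Q‖ * ‖v‖ ≤ (k * ‖v‖ / 2 * δ) * ‖v‖ := by gcongr
      _ = k * ‖v‖ ^ 2 * δ / 2 := by ring
  have h12 : 0 < k * ‖v‖ ^ 2 * δ := by positivity
  linarith [bR.2, bQ.1]

/-- The stereographic projection is conformal. -/
theorem stereoDeriv_cross {a c : E3} (ha : ‖a‖ = 1) (hc : ‖c‖ = 1) (hac : inner ℝ c a = 0)
    {y v : E3} (hy : ‖y‖ = 1) (hyv : inner ℝ y v = 0) :
    stereoDeriv a c y (cross y v) = Complex.I * stereoDeriv a c y v := by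
  have haa := inner_self_of_norm_one ha
  have hcc := inner_self_of_norm_one hc
  have hca : inner ℝ a c = 0 := by rw [real_inner_comm, hac]
  have hbb : inner ℝ (cross c a) (cross c a) = 1 := by
    rw [inner_cross_cross, haa, hcc, hac]; ring
  have hab : inner ℝ a (cross c a) = 0 := by rw [real_inner_comm, inner_cross_right_self]
  have hcb : inner ℝ c (cross c a) = 0 := by rw [real_inner_comm, inner_cross_left_self]
  have hba : inner ℝ (cross c a) a = 0 := inner_cross_right_self c a
  have hbc : inner ℝ (cross c a) c = 0 := inner_cross_left_self c a
  have hyy := inner_eq_frame ha hc hac y y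
  rw [inner_self_of_norm_one hy] at hyy
  rw [inner_eq_frame ha hc hac] at hyv
  have e1 : inner ℝ (cross y v) a =
      inner ℝ y (cross c a) * inner ℝ v c - inner ℝ y c * inner ℝ v (cross c a) := by
    rw [inner_cross_eq_frame ha hc hac, haa, hab, hca]; ring
  have e2 : inner ℝ (cross y v) (cross c a) =
      inner ℝ y c * inner ℝ v a - inner ℝ y a * inner ℝ v c := by
    rw [inner_cross_eq_frame ha hc hac, hba, hbb, hbc]; ring
  have e3 : inner ℝ (cross y v) c =
      inner ℝ y a * inner ℝ v (cross c a) - inner ℝ y (cross c a) * inner ℝ v a := by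
    rw [inner_cross_eq_frame ha hc hac, hac, hcb, hcc]; ring
  apply Complex.ext
  · rw [Complex.I_mul_re, stereoDeriv_re, stereoDeriv_im, e1, e3, ← neg_div]
    congr 1
    linear_combination inner ℝ v (cross c a) * hyy + inner ℝ y (cross c a) * hyv
  · rw [Complex.I_mul_im, stereoDeriv_re, stereoDeriv_im, e2, e3]
    congr 1
    linear_combination -inner ℝ v a * hyy - inner ℝ y a * hyv

theorem stereoDeriv_smul (a c y v : E3) (k : ℝ) :
    stereoDeriv a c y (k • v) = k * stereoDeriv a c y v := by
  apply Complex.ext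
  · rw [Complex.re_ofReal_mul, stereoDeriv_re, stereoDeriv_re, real_inner_smul_left,
      real_inner_smul_left]
    ring
  · rw [Complex.im_ofReal_mul, stereoDeriv_im, stereoDeriv_im, real_inner_smul_left,
      real_inner_smul_left]
    ring

/-- Moving orthogonally to a unit vector leaves the norm stationary, so normalization does not alter
the velocity. -/
theorem hasDerivAt_normalize {y n : E3} (hy : ‖y‖ = 1) (hyn : inner ℝ y n = 0) :
    HasDerivAt (fun δ : ℝ => ‖y + δ • n‖⁻¹ • (y + δ • n)) n 0 := by
  have h1 : HasDerivAt (fun δ : ℝ => y + δ • n) n 0 := by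
    simpa using ((hasDerivAt_id (0 : ℝ)).smul_const n).const_add y
  have h2 : HasDerivAt (fun δ : ℝ => ‖y + δ • n‖ ^ 2) 0 0 := by
    have := h1.norm_sq
    simpa [hyn] using this
  have h3 : HasDerivAt (fun δ : ℝ => ‖y + δ • n‖) 0 0 := by
    have := h2.sqrt (by simp [hy])
    simpa [Real.sqrt_sq (norm_nonneg _)] using this
  have h4 : HasDerivAt (fun δ : ℝ => ‖y + δ • n‖⁻¹) 0 0 := by
    have := h3.fun_inv (by simp [hy])
    simpa using this
  refine (h4.smul h1).congr_deriv ?_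
  simp [hy]

namespace SphereCurve

variable {C : SphereCurve} {s η : ℝ} {a : E3}

/-! ### The interior angle -/

/-- The complex number defining the angle is a positive multiple of -conj(F) G, with F and G the
outgoing and incoming chart velocities, so the formula holds modulo 2π. Both arguments lie in (-π/2,
π/2), which places the right-hand side in (0, 2π) and removes the ambiguity. -/
theorem IsLocalGraph.interiorAngle_eq (h : C.IsLocalGraph s a η) :
    C.interiorAngle s = Real.pi +
      (stereoDeriv a (C.path s) (C.path s) (C.leftDeriv s)).arg -
      (stereoDeriv a (C.path s) (C.path s) (C.rightDeriv s)).arg := by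
  set c := C.path s with hcdef
  set F := stereoDeriv a c c (C.rightDeriv s) with hF
  set G := stereoDeriv a c c (C.leftDeriv s) with hG
  have hc : ‖c‖ = 1 := C.norm_path s
  have ha := h.norm_eq_one
  have hac : inner ℝ c a = 0 := h.inner_eq_zero
  have hF0 : F ≠ 0 := by intro h0; have := h.rightDeriv_re_pos; rw [← hF, h0] at this; simp at this
  have hG0 : G ≠ 0 := by intro h0; have := h.leftDeriv_re_pos; rw [← hG, h0] at this; simp at this
  have bF := abs_lt.1 (Complex.abs_arg_lt_pi_div_two_iff.2 (Or.inl h.rightDeriv_re_pos))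
  have bG := abs_lt.1 (Complex.abs_arg_lt_pi_div_two_iff.2 (Or.inl h.leftDeriv_re_pos))
  rw [← hF] at bF
  rw [← hG] at bG
  have hR0 := norm_pos_iff.2 (C.rightDeriv_ne_zero s)
  have hL0 := norm_pos_iff.2 (C.leftDeriv_ne_zero s)
  -- The 4 undoes the two factors 1/2 of the chart derivative at its centre.
  set k : ℝ := 4 * ‖C.rightDeriv s‖⁻¹ * ‖C.leftDeriv s‖⁻¹ with hk
  have hkpos : 0 < k := by positivity
  have hz : (⟨inner ℝ (rightTangent C.path s) (-leftTangent C.path s),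
      inner ℝ (cross c (rightTangent C.path s)) (-leftTangent C.path s)⟩ : ℂ) =
      k * (-((starRingEnd ℂ) F * G)) := by
    have hcR : inner ℝ (C.rightDeriv s) c = 0 := by
      rw [real_inner_comm]; exact C.inner_path_rightDeriv s
    have hcL : inner ℝ (C.leftDeriv s) c = 0 := by
      rw [real_inner_comm]; exact C.inner_path_leftDeriv s
    have hcc := inner_self_of_norm_one hc
    have hcb : inner ℝ c (cross c a) = 0 := by rw [real_inner_comm, inner_cross_left_self]
    have eF : F = _ := stereoDeriv_self hc hac
    have eG : G = _ := stereoDeriv_self hc hac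
    rw [eF, eG]
    apply Complex.ext
    · rw [Complex.re_ofReal_mul]
      simp only [Complex.neg_re, Complex.mul_re, Complex.conj_re,
        Complex.conj_im]
      rw [inner_neg_right, inner_eq_frame ha hc hac, rightTangent_eq, leftTangent_eq]
      simp only [real_inner_smul_left, hcR, hcL]
      rw [hk]; ring
    · rw [Complex.im_ofReal_mul]
      simp only [Complex.neg_im, Complex.mul_im, Complex.conj_re,
        Complex.conj_im]
      rw [inner_neg_right, inner_cross_eq_frame ha hc hac, rightTangent_eq, leftTangent_eq]
      simp only [real_inner_smul_left, hcR, hcL, hcc, hcb, hac]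
      rw [hk]; ring
  rw [interiorAngle, hz, Complex.arg_real_mul _ hkpos, toIcoMod_eq_iff]
  refine ⟨⟨by linarith, by linarith⟩, ?_⟩
  have hang : ((-((starRingEnd ℂ) F * G)).arg : Real.Angle) =
      ((Real.pi + G.arg - F.arg : ℝ) : Real.Angle) := by
    have hF0' : (starRingEnd ℂ) F ≠ 0 := by simpa using hF0
    rw [Complex.arg_neg_coe_angle (mul_ne_zero hF0' hG0), Complex.arg_mul_coe_angle hF0' hG0,
      Complex.arg_conj_coe_angle, Real.Angle.coe_sub, Real.Angle.coe_add]
    abel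
  obtain ⟨n, hn⟩ := Real.Angle.angle_eq_iff_two_pi_dvd_sub.1 hang
  exact ⟨n, by rw [zsmul_eq_mul]; linarith⟩

/-! ### The two sides of the curve -/

/-- The inverse of the stereographic chart, with values in the sphere. -/
def chartInverse {a c : E3} (ha : ‖a‖ = 1) (hc : ‖c‖ = 1) (hac : inner ℝ c a = 0) (z : ℂ) :
    Sphere2 :=
  ⟨stereoInverse a c z, by simpa using norm_stereoInverse ha hc hac z⟩

theorem continuous_chartInverse {a c : E3} (ha : ‖a‖ = 1) (hc : ‖c‖ = 1)
    (hac : inner ℝ c a = 0) : Continuous (chartInverse ha hc hac) :=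
  continuous_induced_rng.2 (continuous_stereoInverse a c)

/-- Near a point of the curve, the region to the left of the curve is the part above the graph
in the chart, and the other region is the part below it. -/
theorem IsLocalGraph.eventually_sides (h : C.IsLocalGraph s a η)
    {S₁ S₂ : Set Sphere2} (hdiv : C.Divides S₁ S₂) (hor : C.PositivelyOriented S₂) :
    (∀ᶠ x : Sphere2 in 𝓝[S₂] (C.pt s), ∀ τ ∈ Icc (s - η) (s + η),
      (C.chart a s τ).re = (stereo a (C.path s) x).re →
        (C.chart a s τ).im < (stereo a (C.path s) x).im) ∧
    (∀ᶠ x : Sphere2 in 𝓝[S₁] (C.pt s), ∀ τ ∈ Icc (s - η) (s + η),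
      (C.chart a s τ).re = (stereo a (C.path s) x).re →
        (stereo a (C.path s) x).im < (C.chart a s τ).im) := by
  have ha := h.norm_eq_one
  have hc : ‖C.path s‖ = 1 := C.norm_path s
  have hac := h.inner_eq_zero
  have hη := h.pos
  have hN := C.N_pos_real
  set T : ℂ → Sphere2 := chartInverse ha hc hac with hT
  have hTc : Continuous T := continuous_chartInverse ha hc hac
  have hST (z : ℂ) : stereo a (C.path s) (T z) = z := stereo_stereoInverse ha hc hac z
  have hTS (x : Sphere2) (hx : 1 + inner ℝ (x : E3) (C.path s) ≠ 0) :
      T (stereo a (C.path s) x) = x :=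
    Subtype.ext (stereoInverse_stereo ha hc hac (by simp) hx)
  have hTY (τ : ℝ) (hτ : τ ∈ Icc (s - η) (s + η)) : T (C.chart a s τ) = C.pt τ :=
    hTS (C.pt τ) (h.denom_pos τ hτ).ne'
  have hs : s ∈ Icc (s - η) (s + η) := ⟨by linarith, by linarith⟩
  have hT0 : T 0 = C.pt s := by rw [← hTY s hs, chart_self hac]
  set Y := C.chart a s with hY
  have hY0 : Y s = 0 := chart_self hac
  have hYc : ∀ τ ∈ Icc (s - η) (s + η), ContinuousAt Y τ := fun τ hτ =>
    continuousAt_chart (h.denom_pos τ hτ).ne'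
  -- the part of the curve outside the chart stays away from the centre
  have hfar : IsClosed (C.pt '' Icc (s + η) (s - η + C.N)) :=
    (isCompact_Icc.image C.continuous_pt).isClosed
  have hfar0 : C.pt s ∉ C.pt '' Icc (s + η) (s - η + C.N) := by
    rintro ⟨τ, hτ, he⟩
    exact C.path_ne_of_mem_far hη hτ (congrArg Subtype.val he)
  have hnhd : ∀ᶠ z in 𝓝 (0 : ℂ), T z ∉ C.pt '' Icc (s + η) (s - η + C.N) := by
    have := hTc.continuousAt (x := 0)
    exact this.eventually (by rw [hT0]; exact hfar.isOpen_compl.mem_nhds hfar0)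
  obtain ⟨ρ, hρ, hρT⟩ := Metric.eventually_nhds_iff.1 hnhd
  -- With curve points below ρ/4 in norm and strip heights below ρ/2, the strips stay in the ball of
  -- radius ρ, while any chart point below ρ/4 differs in height from the curve by less than ρ/2.
  obtain ⟨η', hη', hYsmall⟩ := Metric.continuousAt_iff.1 (hYc s hs) (ρ / 4) (by positivity)
  set θ := min (η / 2) (η' / 2) with hθ
  have hθpos : 0 < θ := lt_min (half_pos hη) (half_pos hη')
  have hθη : θ ≤ η / 2 := min_le_left _ _
  have hθη' : θ ≤ η' / 2 := min_le_right _ _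
  have hθsub : Icc (s - θ) (s + θ) ⊆ Icc (s - η) (s + η) :=
    Icc_subset_Icc (by linarith) (by linarith)
  have hYsm : ∀ τ ∈ Icc (s - θ) (s + θ), ‖Y τ‖ < ρ / 4 := by
    intro τ hτ
    have : dist τ s < η' := by
      rw [Real.dist_eq, abs_lt]; constructor <;> linarith [hτ.1, hτ.2]
    have := hYsmall this
    rwa [hY0, dist_zero_right] at this
  -- the two sides of the curve
  set Q : Set (ℝ × ℝ) := Ioo (s - θ) (s + θ) ×ˢ Ioo 0 (ρ / 2) with hQ
  set P : ℝ → Set Sphere2 := fun e => (fun p : ℝ × ℝ => T (Y p.1 + (e * p.2 : ℝ) * Complex.I)) '' Q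
    with hP
  have hPconn (e : ℝ) : IsPreconnected (P e) := by
    refine (isPreconnected_Ioo.prod isPreconnected_Ioo).image _ ?_
    intro p hp
    have hp1 : p.1 ∈ Icc (s - η) (s + η) := hθsub (Ioo_subset_Icc_self hp.1)
    have c1 : ContinuousAt (fun p : ℝ × ℝ => Y p.1) p :=
      ContinuousAt.comp (g := Y) (hYc p.1 hp1) continuousAt_fst
    have c2 : ContinuousAt (fun p : ℝ × ℝ => ((e * p.2 : ℝ) : ℂ) * Complex.I) p := by fun_prop
    exact (ContinuousAt.comp (g := T) hTc.continuousAt (c1.add c2)).continuousWithinAt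
  have hinj {τ σ : ℝ} (hτ : τ ∈ Icc (s - η) (s + η)) (hσ : σ ∈ Icc (s - η) (s + η))
      (he : (Y τ).re = (Y σ).re) : τ = σ := h.strictMonoOn.injOn hτ hσ he
  -- A strip point cannot lie on the far part of the curve, being within ρ of the centre, nor on the
  -- near part, where the graph has only one point over each real coordinate.
  have hPcompl (e : ℝ) (he : |e| = 1) : P e ⊆ C.carrierᶜ := by
    rintro _ ⟨⟨τ, l⟩, ⟨hτ, hl⟩, rfl⟩ ⟨σ₀, hσ₀⟩
    have he0 : e ≠ 0 := by rintro rfl; simp at he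
    obtain ⟨σ, hσ, hσeq⟩ := C.periodic.exists_mem_Ico hN σ₀ (s - η)
    rw [hσeq] at hσ₀
    simp only at hσ₀ hτ hl
    have hnorm : dist (Y τ + (e * l : ℝ) * Complex.I) 0 < ρ := by
      rw [dist_zero_right]
      have h1 := norm_add_le (Y τ) (((e * l : ℝ) : ℂ) * Complex.I)
      have h2 : ‖((e * l : ℝ) : ℂ) * Complex.I‖ = l := by
        rw [norm_mul, Complex.norm_I, mul_one, Complex.norm_real, Real.norm_eq_abs, abs_mul, he,
          one_mul, abs_of_pos hl.1]
      have h3 := hYsm τ (Ioo_subset_Icc_self hτ)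
      linarith [hl.2]
    rcases le_or_gt (s + η) σ with hle | hlt
    · exact hρT hnorm ⟨σ, ⟨hle, hσ.2.le⟩, hσ₀⟩
    · have hσm : σ ∈ Icc (s - η) (s + η) := ⟨hσ.1, hlt.le⟩
      have heq : Y σ = Y τ + (e * l : ℝ) * Complex.I := by
        rw [← hST (Y τ + (e * l : ℝ) * Complex.I), ← hσ₀]; rfl
      have hτσ : σ = τ := hinj hσm (hθsub (Ioo_subset_Icc_self hτ)) (by rw [heq]; simp)
      rw [hτσ] at heq
      have : ((e * l : ℝ) : ℂ) * Complex.I = 0 := by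
        have h0 := heq; rw [left_eq_add] at h0; exact h0
      rw [mul_eq_zero, Complex.ofReal_eq_zero] at this
      rcases this with h0 | h0
      · exact (mul_ne_zero he0 hl.1.ne') h0
      · exact Complex.I_ne_zero h0
  have hPabove : ∀ x ∈ P 1, ∀ τ ∈ Icc (s - η) (s + η),
      (Y τ).re = (stereo a (C.path s) x).re → (Y τ).im < (stereo a (C.path s) x).im := by
    rintro _ ⟨⟨τ, l⟩, ⟨hτ, hl⟩, rfl⟩ σ hσ hre
    simp only at hτ hl
    simp only [hST] at hre ⊢
    have : σ = τ := hinj hσ (hθsub (Ioo_subset_Icc_self hτ)) (by rw [hre]; simp)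
    rw [this]; simpa using hl.1
  have hPbelow : ∀ x ∈ P (-1), ∀ τ ∈ Icc (s - η) (s + η),
      (Y τ).re = (stereo a (C.path s) x).re → (stereo a (C.path s) x).im < (Y τ).im := by
    rintro _ ⟨⟨τ, l⟩, ⟨hτ, hl⟩, rfl⟩ σ hσ hre
    simp only at hτ hl
    simp only [hST] at hre ⊢
    have : σ = τ := hinj hσ (hθsub (Ioo_subset_Icc_self hτ)) (by rw [hre]; simp)
    rw [this]; simpa using hl.1
  have hneg : (Y (s - θ)).re < 0 := h.chart_re_neg (by linarith) (by linarith)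
  have hposi : 0 < (Y (s + θ)).re := h.chart_re_pos (by linarith) (by linarith)
  -- The intermediate value theorem provides a curve point over the real coordinate of `x`;
  -- comparing heights puts `x` on the curve or in one of the two strips.
  have hcover : ∀ᶠ x : Sphere2 in 𝓝 (C.pt s), 1 + inner ℝ (x : E3) (C.path s) ≠ 0 ∧
      (x ∈ C.carrier ∨ ∃ τ ∈ Icc (s - η) (s + η), (Y τ).re = (stereo a (C.path s) x).re ∧
        (((Y τ).im < (stereo a (C.path s) x).im ∧ x ∈ P 1) ∨
          ((stereo a (C.path s) x).im < (Y τ).im ∧ x ∈ P (-1)))) := by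
    have hden := eventually_one_add_inner_ne (C.pt s) univ
    rw [nhdsWithin_univ] at hden
    have hSc : Tendsto (fun x : Sphere2 => stereo a (C.path s) x) (𝓝 (C.pt s)) (𝓝 0) := by
      have h1 := continuousAt_stereo a (C.path s) (y := C.path s)
        (by rw [one_add_inner_self]; norm_num)
      have h2 := h1.tendsto.comp (continuous_subtype_val.continuousAt (x := C.pt s)).tendsto
      rwa [stereo_self hac] at h2
    have hsm : ∀ᶠ x : Sphere2 in 𝓝 (C.pt s), ‖stereo a (C.path s) x‖ < ρ / 4 := by
      have := hSc.norm.eventually (gt_mem_nhds (show ‖(0 : ℂ)‖ < ρ / 4 by simpa using hρ))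
      exact this
    have hre := (Complex.continuous_re.tendsto _).comp hSc
    rw [Complex.zero_re] at hre
    filter_upwards [hden, hsm, hre.eventually (lt_mem_nhds hneg),
      hre.eventually (gt_mem_nhds hposi)] with x h1 h2 h3 h4
    refine ⟨h1, ?_⟩
    have hcontre : ContinuousOn (fun τ => (Y τ).re) (Icc (s - θ) (s + θ)) := fun τ hτ =>
      (Complex.continuous_re.continuousAt.comp (hYc τ (hθsub hτ))).continuousWithinAt
    obtain ⟨τ, hτ, hτre⟩ := intermediate_value_Ioo (by linarith) hcontre ⟨h3, h4⟩
    simp only [Function.comp_apply] at hτre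
    have hτ' := Ioo_subset_Icc_self hτ
    have hYτ := hYsm τ hτ'
    have b1 := abs_le.1 ((Complex.abs_im_le_norm _).trans hYτ.le)
    have b2 := abs_lt.1 ((Complex.abs_im_le_norm _).trans_lt h2)
    rcases lt_trichotomy (Y τ).im (stereo a (C.path s) x).im with hlt | heq | hlt
    · refine Or.inr ⟨τ, hθsub hτ', hτre, Or.inl ⟨hlt, (τ, (stereo a (C.path s) x).im - (Y τ).im),
        ⟨hτ, by simp only [mem_Ioo]; constructor <;> linarith⟩, ?_⟩⟩
      have e : Y τ + ((1 * ((stereo a (C.path s) x).im - (Y τ).im) : ℝ) : ℂ) * Complex.I =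
          stereo a (C.path s) x := by
        apply Complex.ext
        · simp [hτre]
        · simp
      simp only [e]
      exact hTS x h1
    · left
      have e : Y τ = stereo a (C.path s) x := Complex.ext hτre heq
      exact ⟨τ, by rw [← hTY τ (hθsub hτ'), ← hTS x h1, ← e]⟩
    · refine Or.inr ⟨τ, hθsub hτ', hτre, Or.inr ⟨hlt, (τ, (Y τ).im - (stereo a (C.path s) x).im),
        ⟨hτ, by simp only [mem_Ioo]; constructor <;> linarith⟩, ?_⟩⟩
      have e : Y τ + ((-1 * ((Y τ).im - (stereo a (C.path s) x).im) : ℝ) : ℂ) * Complex.I =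
          stereo a (C.path s) x := by
        apply Complex.ext
        · simp [hτre]
        · simp
      simp only [e]
      exact hTS x h1
  have hsub (e : ℝ) (he : |e| = 1) : P e ⊆ S₁ ∨ P e ⊆ S₂ :=
    IsPreconnected.subset_or_subset hdiv.isOpen_fst hdiv.isOpen_snd hdiv.disjoint
      (by rw [hdiv.union_eq]; exact hPcompl e he) (hPconn e)
  have hdisjC₁ : ∀ x ∈ S₁, x ∉ C.carrier := fun x hx => by
    have : x ∈ C.carrierᶜ := hdiv.union_eq ▸ Or.inl hx
    exact this
  have hdisjC₂ : ∀ x ∈ S₂, x ∉ C.carrier := fun x hx => by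
    have : x ∈ C.carrierᶜ := hdiv.union_eq ▸ Or.inr hx
    exact this
  -- a point of `S₂` above the graph
  have hmeet : ∃ x ∈ S₂, x ∈ P 1 := by
    obtain ⟨U, hUsub, hUo, hUs⟩ := mem_nhds_iff.1 hcover
    -- The orientation is prescribed only at interior points of arcs, so it is read off at a
    -- parameter `σ` slightly beyond `s` and before the next integer.
    obtain ⟨k, hk⟩ := exists_mem_Ico s
    have hev : ∀ᶠ σ in 𝓝[>] s, C.pt σ ∈ U ∧ σ < s + η ∧ σ < k + 1 ∧ s < σ := by
      have e1 : ∀ᶠ σ in 𝓝[>] s, C.pt σ ∈ U :=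
        nhdsWithin_le_nhds (C.continuous_pt.continuousAt.eventually (hUo.mem_nhds hUs))
      have e2 : ∀ᶠ σ in 𝓝[>] s, σ < s + η :=
        nhdsWithin_le_nhds (gt_mem_nhds (by linarith))
      have e3 : ∀ᶠ σ : ℝ in 𝓝[>] s, σ < k + 1 := nhdsWithin_le_nhds (gt_mem_nhds hk.2)
      filter_upwards [e1, e2, e3, self_mem_nhdsWithin] with σ h1 h2 h3 h4
      exact ⟨h1, h2, h3, h4⟩
    obtain ⟨σ, hσU, hση, hσk, hsσ⟩ := hev.exists
    have hσint : ∀ j : ℤ, σ ≠ j := by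
      rintro j rfl
      have h1 : (k : ℝ) < j := hk.1.trans_lt hsσ
      have h2 : k < j := by exact_mod_cast h1
      have h3 : j < k + 1 := by exact_mod_cast hσk
      omega
    have hσm : σ ∈ Ioo (s - η) (s + η) := ⟨by linarith, hση⟩
    have hσm' := Ioo_subset_Icc_self hσm
    have hd := h.differentiableAt σ hσm hsσ.ne'
    have hdne : deriv C.path σ ≠ 0 := by
      intro h0
      have := h.deriv_re_pos σ hσm hsσ.ne'
      rw [chartDeriv, h0, stereoDeriv_re] at this
      simp at this
    have htan : C.tangent σ = ‖deriv C.path σ‖⁻¹ • deriv C.path σ := by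
      rw [tangent, rightTangent, hd.derivWithin (uniqueDiffOn_Ici σ σ self_mem_Ici)]
    have hyt : inner ℝ (C.path σ) (C.tangent σ) = 0 := by
      rw [htan, real_inner_smul_right, C.inner_path_deriv, mul_zero]
    set f : ℝ → E3 := fun δ => ‖C.path σ + δ • cross (C.path σ) (C.tangent σ)‖⁻¹ •
      (C.path σ + δ • cross (C.path σ) (C.tangent σ)) with hf
    have hf0 : f 0 = C.path σ := by simp [hf, C.norm_path]
    have hfd : HasDerivAt f (cross (C.path σ) (C.tangent σ)) 0 :=
      hasDerivAt_normalize (C.norm_path σ)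
        (by rw [real_inner_comm]; exact inner_cross_left_self _ _)
    have hXd : HasDerivAt (fun δ => stereo a (C.path s) (f δ))
        (((‖deriv C.path σ‖⁻¹ : ℝ) : ℂ) * Complex.I * C.chartDeriv a s σ) 0 := by
      have h1 := hasDerivAt_stereo a (C.path s) hfd
        (by rw [hf0]; exact (h.denom_pos σ hσm').ne')
      rw [hf0, stereoDeriv_cross ha hc hac (C.norm_path σ) hyt, htan,
        stereoDeriv_smul] at h1
      convert h1 using 1
      rw [chartDeriv]; ring
    have habove := eventually_above_of_normal h.strictMonoOn hσm
      (hasDerivAt_chart hd (h.denom_pos σ hσm').ne') (h.deriv_re_pos σ hσm hsσ.ne')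
      (inv_pos.2 (norm_pos_iff.2 hdne)) hXd (by simp only [hf0]; rfl)
    have hUev : ∀ᶠ δ in 𝓝[>] (0 : ℝ), ∀ z : Sphere2, (z : E3) = f δ → z ∈ U := by
      obtain ⟨V, hVo, hVU⟩ := isOpen_induced_iff.1 hUo
      have hV : ∀ᶠ δ in 𝓝[>] (0 : ℝ), f δ ∈ V := by
        refine nhdsWithin_le_nhds (hfd.continuousAt.eventually (hVo.mem_nhds ?_))
        rw [hf0]
        have : C.pt σ ∈ Subtype.val ⁻¹' V := by rw [hVU]; exact hσU
        exact this
      filter_upwards [hV] with δ hδ z hz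
      rw [← hVU, mem_preimage, hz]
      exact hδ
    -- Three requirements hold together for small δ: the normal point is above the graph, it lies in
    -- the neighbourhood covered by curve and strips, and the orientation puts it in `S₂`.
    obtain ⟨δ, hab, hUδ, z, hzS, hz⟩ := (habove.and (hUev.and (hor σ hσint))).exists
    obtain ⟨-, hz2⟩ := hUsub (hUδ z hz)
    refine ⟨z, hzS, ?_⟩
    rcases hz2 with hz2 | ⟨τ, hτ, hre, hz2⟩
    · exact absurd hz2 (hdisjC₂ z hzS)
    · have hzf : stereo a (C.path s) z = stereo a (C.path s) (f δ) := by rw [hz]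
      have hlt := hab τ hτ (by rw [← hzf]; exact hre)
      rcases hz2 with hz2 | hz2
      · exact hz2.2
      · rw [← hzf] at hlt
        exact absurd hlt (not_lt.2 hz2.1.le)
  have hP₂ : P 1 ⊆ S₂ := by
    rcases hsub 1 (by simp) with h1 | h1
    · obtain ⟨x, hx2, hxP⟩ := hmeet
      exact absurd hx2 (disjoint_left.1 hdiv.disjoint (h1 hxP))
    · exact h1
  -- Were the lower strip in `S₂` too, `S₁` would miss a whole neighbourhood of `C.pt s`, contrary
  -- to that point being in its frontier.
  have hP₁ : P (-1) ⊆ S₁ := by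
    rcases hsub (-1) (by simp) with h1 | h1
    · exact h1
    · exfalso
      have hcl : C.pt s ∈ closure S₁ := frontier_subset_closure
        (by rw [hdiv.frontier_fst]; exact mem_range_self s)
      obtain ⟨x, ⟨-, hx⟩, hxS⟩ := mem_closure_iff_nhds.1 hcl _ hcover
      rcases hx with hx | ⟨τ, -, -, hx | hx⟩
      · exact hdisjC₁ x hxS hx
      · exact disjoint_left.1 hdiv.disjoint hxS (hP₂ hx.2)
      · exact disjoint_left.1 hdiv.disjoint hxS (h1 hx.2)
  constructor
  · filter_upwards [self_mem_nhdsWithin, nhdsWithin_le_nhds hcover] with x hxS ⟨_, hx⟩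
    rcases hx with hx | ⟨τ, -, -, hx | hx⟩
    · exact absurd hx (hdisjC₂ x hxS)
    · exact hPabove x hx.2
    · exact absurd hxS (disjoint_left.1 hdiv.disjoint (hP₁ hx.2))
  · filter_upwards [self_mem_nhdsWithin, nhdsWithin_le_nhds hcover] with x hxS ⟨_, hx⟩
    rcases hx with hx | ⟨τ, -, -, hx | hx⟩
    · exact absurd hx (hdisjC₁ x hxS)
    · exact absurd (hP₂ hx.2) (disjoint_left.1 hdiv.disjoint hxS)
    · exact hPbelow x hx.2

end SphereCurve

end

/-! ### The two one-sided limits and the final assembly -/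

namespace SphereCurve

variable {C : SphereCurve}

/-- Limits of the double layer potential from both sides, for one tangent field. -/
theorem tendsto_doubleLayer_sides {S₁ S₂ : Set Sphere2} (hdiv : C.Divides S₁ S₂)
    (hor : C.PositivelyOriented S₂) {μ : Sphere2 → ℝ} (hμ : ContinuousOn μ C.carrier) (s : ℝ) :
    Tendsto (C.doubleLayer C.tangent μ) (𝓝[S₂] (C.pt s))
      (𝓝 ((∫ τ in (0 : ℝ)..C.N, μ (C.pt τ) * C.kernel (C.path s) τ) +
        (1 - C.interiorAngle s / (2 * Real.pi)) * μ (C.pt s))) ∧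
    Tendsto (C.doubleLayer C.tangent μ) (𝓝[S₁] (C.pt s))
      (𝓝 ((∫ τ in (0 : ℝ)..C.N, μ (C.pt τ) * C.kernel (C.path s) τ) +
        -(C.interiorAngle s / (2 * Real.pi)) * μ (C.pt s))) := by
  obtain ⟨a, η, h⟩ := C.exists_isLocalGraph s
  obtain ⟨η₀, hη₀, _, _, hki⟩ := C.exists_integral_kernel_bound s
  obtain ⟨habove, hbelow⟩ := h.eventually_sides hdiv hor
  have hangle := h.interiorAngle_eq
  have hsub {η' : ℝ} (hle : η' ≤ min η η₀) :
      Icc (s - η') (s + η') ⊆ Icc (s - η) (s + η) := by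
    have := hle.trans (min_le_left _ _)
    exact Icc_subset_Icc (by linarith) (by linarith)
  have hcompl : S₁ ∪ S₂ ⊆ C.carrierᶜ := hdiv.union_eq.subset
  constructor
  · refine tendsto_doubleLayer hμ s
      (disjoint_left.2 fun x hx => hcompl (Or.inr hx)) ⟨min η η₀, lt_min h.pos hη₀, ?_⟩
    intro η' hη' hle
    have hJ := (h.mono hη' (hle.trans (min_le_left _ _))).tendsto_integral_above (D := S₂)
      (fun x hx => (hki η' hη' (hle.trans (min_le_right _ _)) x hx).1)
      (habove.mono fun x hx τ hτ => hx τ (hsub hle hτ))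
    -- Substituting the interior angle turns (π + arg R - arg L) / 2π into 1 - α / 2π.
    convert hJ using 2
    rw [hangle]
    field_simp
    ring
  · refine tendsto_doubleLayer hμ s
      (disjoint_left.2 fun x hx => hcompl (Or.inl hx)) ⟨min η η₀, lt_min h.pos hη₀, ?_⟩
    intro η' hη' hle
    have hJ := (h.mono hη' (hle.trans (min_le_left _ _))).tendsto_integral_below (D := S₁)
      (fun x hx => (hki η' hη' (hle.trans (min_le_right _ _)) x hx).1)
      (hbelow.mono fun x hx τ hτ => hx τ (hsub hle hτ))
    -- With -π in place of π the same substitution gives -α / 2π.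
    convert hJ using 2
    rw [hangle]
    field_simp
    ring

/-- Equal unit tangents make the one-sided derivatives positive multiples of each other, so their
arguments in the chart cancel. -/
theorem interiorAngle_eq_pi {s : ℝ} (ht : leftTangent C.path s = rightTangent C.path s) :
    C.interiorAngle s = Real.pi := by
  obtain ⟨a, η, h⟩ := C.exists_isLocalGraph s
  have hR0 := norm_pos_iff.2 (C.rightDeriv_ne_zero s)
  have hL0 := norm_pos_iff.2 (C.leftDeriv_ne_zero s)
  have hv : C.leftDeriv s = (‖C.leftDeriv s‖ * ‖C.rightDeriv s‖⁻¹) • C.rightDeriv s := by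
    rw [mul_smul, ← rightTangent_eq, ← ht, leftTangent_eq, smul_smul, mul_inv_cancel₀ hL0.ne',
      one_smul]
  rw [h.interiorAngle_eq, hv, stereoDeriv_smul, Complex.arg_real_mul _ (by positivity)]
  ring

end SphereCurve

/-- The trace from `S₂` is formed with the unit tangent `t` oriented in accordance with `S₂`, the
trace from `S₁` with the opposite unit tangent `-t`, which is oriented in accordance with `S₁`. -/
theorem mainTheorem3 (C : SphereCurve) (S₁ S₂ : Set Sphere2)
    (hdiv : C.Divides S₁ S₂) (hor : C.PositivelyOriented S₂)
    (μ : Sphere2 → ℝ) (hμ : ContinuousOn μ C.carrier) (s : ℝ) :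
    Tendsto (C.truncK C.tangent μ (C.pt s)) (𝓝[>] 0) (𝓝 (C.K C.tangent μ (C.pt s))) ∧
    Tendsto (C.doubleLayer C.tangent μ) (𝓝[S₂] (C.pt s))
      (𝓝 (trace S₂ (C.doubleLayer C.tangent μ) (C.pt s))) ∧
    trace S₂ (C.doubleLayer C.tangent μ) (C.pt s) =
      C.K C.tangent μ (C.pt s) + (1 - C.interiorAngle s / (2 * Real.pi)) * μ (C.pt s) ∧
    (leftTangent C.path s = rightTangent C.path s → C.interiorAngle s = Real.pi) ∧
    Tendsto (C.doubleLayer (-C.tangent) μ) (𝓝[S₁] (C.pt s))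
      (𝓝 (trace S₁ (C.doubleLayer (-C.tangent) μ) (C.pt s))) ∧
    trace S₂ (C.doubleLayer C.tangent μ) (C.pt s) +
      trace S₁ (C.doubleLayer (-C.tangent) μ) (C.pt s) = μ (C.pt s) := by
  have hmem : C.pt s ∈ C.carrier := mem_range_self s
  -- Limits chosen by `limUnder` are determined only along nontrivial filters; here this holds
  -- because the point lies in the frontier of both regions.
  have : (𝓝[S₁] (C.pt s)).NeBot :=
    mem_closure_iff_nhdsWithin_neBot.1
      (frontier_subset_closure (by rw [hdiv.frontier_fst]; exact hmem))
  have : (𝓝[S₂] (C.pt s)).NeBot :=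
    mem_closure_iff_nhdsWithin_neBot.1
      (frontier_subset_closure (by rw [hdiv.frontier_snd]; exact hmem))
  have hK := SphereCurve.tendsto_truncK hμ s
  obtain ⟨h2, h1⟩ := SphereCurve.tendsto_doubleLayer_sides hdiv hor hμ s
  -- Reversing the tangent negates the potential, so in the final sum the principal values and the
  -- angle terms cancel and only μ remains.
  have h1' : Tendsto (C.doubleLayer (-C.tangent) μ) (𝓝[S₁] (C.pt s)) _ :=
    h1.neg.congr fun x => (SphereCurve.doubleLayer_neg C.tangent x).symm
  have eK : C.K C.tangent μ (C.pt s) = _ := hK.limUnder_eq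
  have e2 : trace S₂ (C.doubleLayer C.tangent μ) (C.pt s) = _ := h2.limUnder_eq
  have e1 : trace S₁ (C.doubleLayer (-C.tangent) μ) (C.pt s) = _ := h1'.limUnder_eq
  rw [eK, e2, e1]
  refine ⟨hK, h2, rfl, SphereCurve.interiorAngle_eq_pi, h1', ?_⟩
  ring
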